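/- Fix $\sigma>0$. For $d\ge1$, $N\ge2$ and $L\ge0$, a model on $[N]^d=\{1,\dots,N\}^d$ allows us to simulate, at any $x\in[N]^d$, a random output $F(x,\xi_x)$; all simulation runs are independent. Let $\mathcal{MC}=\mathcal{MC}(d,N,\sigma,L)$ be the class of models for which * $f(x)=\mathbb E[F(x,\xi_x)]$ is $L^\natural$-convex, i.e. $f(x)+f(y)\ge f(\lceil (x+y)/2\rceil)+f(\lfloor (x+y)/2\rfloor)$ for all $x,y\in[N]^d$ (componentwise rounding); * $|f(x)-f(y)|\le L$ whenever $\|x-y\|_\infty\le1$; * every $F(x,\xi_x)-f(x)$ is sub-Gaussian with parameter $\sigma^2$, i.e. $\mathbb E\,e^{s(F(x,\xi_x)-f(x))}\le e^{\sigma^2s^2/2}$ for all $s\in\mathbb R$. An $(\epsilon,\delta)$-PGS solution is a random $\hat x\in[N]^d$ with $\mathbb P\big(f(\hat x)\le\min f+\epsilon\big)\ge1-\delta$. A (sequential) simulation algorithm consists of a sampling, a stopping and a recommendation rule based on the outputs observed so far; its simulation cost $\tau$ is the number of simulations run. Let $T(\epsilon,\delta,\mathcal{MC})$ be the infimum, over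 all simulation algorithms that stop almost surely and return an $(\epsilon,\delta)$-PGS solution for every model in $\mathcal{MC}$, of $\sup_{\mathcal{MC}}\mathbb E[\tau]$. Neighbouring points. For $x\in[1,N]^d$ let $y\in[N-1]^d$ with $x\in y+[0,1]^d$ ($y_k=\lfloor x_k\rfloor$, or $N-1$ if $x_k=N$), let $\alpha_x$ be a permutation that sorts the coordinates of $x-y$ in nonincreasing order, and let $S^{x,i}=y+\sum_{j\le i}e_{\alpha_x(j)}$ for $0\le i\le d$. (These are the points on which the piecewise Lovász extension of $f$ interpolates at $x$.) Projected and truncated stochastic subgradient descent (SSGD) with $T$ iterations, threshold $M$ and step size $\eta$: start at $x^0=(N/2,\dots,N/2)$; for $t=0,\dots,T-1$ form, with $2d$ fresh simulations, the stochastic subgradient $\hat g^t_{\alpha(i)}=F(S^{x^t,i},\xi^1_i)-F(S^{x^t,i-1},\xi^2_{i-1})$, $i=1,\dots,d$, $\alpha=\alpha_{x^t}$; truncate it componentwise to $[-M,M]$, giving $\tilde g^t$; and let $x^{t+1}$ be the componentwise projection of $x^t-\eta\tilde g^t$ onto $[1,N]^d$. Rounding: let $\bar x=\frac1T\sum_{t<T}x^t$,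 simulate each of $S^{\bar x,0},\dots,S^{\bar x,d}$ afresh $\lceil 32\sigma^2\epsilon^{-2}\log(8/\delta)\rceil$ times (so that each $1-\delta/4$ Hoeffding confidence half-width is at most $\epsilon/4$), and return the one with the smallest empirical mean. Theorem. There are constants $a_1,a_2,b_1,b_2,c_1,c_2>0$ that depend only on $\sigma$ such that for all $d\ge1$, $N\ge2$, $L\ge0$, $\epsilon>0$ there are $\delta_0>0$ and $a_3,b_3,c_3$, depending only on $\sigma,d,N,L,\epsilon$, with $\delta_0\ge\frac1{d+1}$ if $\epsilon\le1$, such that the following holds for all $0<\delta\le\delta_0$. There are a positive integer $T$ and a real $M>0$, not depending on the model, with $$a_1\,\tfrac{dN^2}{\epsilon^2}\log\tfrac1\delta\le T\le a_2\,\tfrac{dN^2}{\epsilon^2}\log\tfrac1\delta+a_3,\qquad b_1\sqrt{\log\tfrac{dNT}{\epsilon}}\le M\le b_2\sqrt{\log\tfrac{dNT}{\epsilon}}+b_3$$ (a square root of a negative number being read as $0$) such that SSGD with these $T,M$ and $\eta=N/(M\sqrt T)$, followed by rounding, stops almost surely and returns an $(\epsilon,\delta)$-PGS solution for every model in $\mathcal{MC}$.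 Its simulation cost, for every model in $\mathcal{MC}$ almost surely, and hence also $T(\epsilon,\delta,\mathcal{MC})$, is at most $$c_1\left[\frac{d^2N^2}{\epsilon^2}\log\frac1\delta+\frac{d^3N^2}{\epsilon^2}\log\frac{d^2N}{\epsilon^3}+\frac{d^3N^2L^2}{\epsilon^2}\right].$$ In particular $T(\epsilon,\delta,\mathcal{MC})\le c_2\frac{d^2N^2}{\epsilon^2}\log\frac1\delta+c_3$. -/

import Mathlib

open MeasureTheory ProbabilityTheory

universe u

noncomputable section

/-! ### The decision space and discrete convexity -/

/-- The decision space `[N]^d`, where `[N] = {1, …, N}`. -/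
abbrev Grid (d N : ℕ) : Type := Fin d → Set.Icc (1 : ℤ) (N : ℤ)

/-- The componentwise rounded-down midpoint `⌊(x + y) / 2⌋`. -/
def Grid.midFloor {d N : ℕ} (x y : Grid d N) : Grid d N := fun i =>
  ⟨((x i : ℤ) + (y i : ℤ)) / 2, by
    have hx := (x i).2
    have hy := (y i).2
    simp only [Set.mem_Icc] at hx hy ⊢
    omega⟩

/-- The componentwise rounded-up midpoint `⌈(x + y) / 2⌉`. -/
def Grid.midCeil {d N : ℕ} (x y : Grid d N) : Grid d N := fun i =>
  ⟨((x i : ℤ) + (y i : ℤ) + 1) / 2, by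
    have hx := (x i).2
    have hy := (y i).2
    simp only [Set.mem_Icc] at hx hy ⊢
    omega⟩

/-- `L♮`-convexity on `[N]^d`: the discrete midpoint convexity. -/
def LNaturalConvex {d N : ℕ} (f : Grid d N → ℝ) : Prop :=
  ∀ x y : Grid d N, f (x.midCeil y) + f (x.midFloor y) ≤ f x + f y

/-- `f` has `ℓ_∞`-Lipschitz constant `L`: `|f x - f y| ≤ L` whenever `‖x - y‖_∞ ≤ 1`. -/
def LInftyLipschitz {d N : ℕ} (L : ℝ) (f : Grid d N → ℝ) : Prop :=
  ∀ x y : Grid d N, (∀ i, |(x i : ℤ) - (y i : ℤ)| ≤ 1) → |f x - f y| ≤ L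

/-! ### Models -/

/-- A model on `[N]^d`: a space of randomness `Y`, the law of the random object `ξ_x` of every
system `x`, and the deterministic function `F`; a simulation of `x` outputs `F(x, ξ_x)`. -/
structure SimModel (d N : ℕ) : Type (u + 1) where
  Y : Type u
  [mY : MeasurableSpace Y]
  law : Grid d N → Measure Y
  [isProb : ∀ x, IsProbabilityMeasure (law x)]
  F : Grid d N → Y → ℝ
  measurable_F : ∀ x, Measurable (F x)

attribute [instance] SimModel.mY SimModel.isProb

namespace SimModel

variable {d N : ℕ}

/-- The objective function `f(x) = 𝔼[F(x, ξ_x)]`. -/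
def objective (𝓜 : SimModel.{u} d N) (x : Grid d N) : ℝ := ∫ y, 𝓜.F x y ∂(𝓜.law x)

/-- The sample space of all simulations: `ω (n, x)` is the random object that is used if the
`n`-th simulation run is a run of system `x`. -/
abbrev Sample (𝓜 : SimModel.{u} d N) : Type u := ℕ × Grid d N → 𝓜.Y

/-- All the random objects `ω (n, x)` are independent, and `ω (n, x)` is a copy of `ξ_x`. -/
def prob (𝓜 : SimModel.{u} d N) : Measure 𝓜.Sample :=
  Measure.infinitePi fun p : ℕ × Grid d N => 𝓜.law p.2

/-- The output of the `n`-th simulation run if it is a run of system `x`. -/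
def output (𝓜 : SimModel.{u} d N) (ω : 𝓜.Sample) (n : ℕ) (x : Grid d N) : ℝ := 𝓜.F x (ω (n, x))

end SimModel

/-- The class of models on `[N]^d` whose objective is `L♮`-convex with `ℓ_∞`-Lipschitz constant
`L` and whose simulation outputs are sub-Gaussian with parameter `σ²`. -/
def convexModels (d N : ℕ) (σ L : ℝ) : Set (SimModel.{u} d N) :=
  {𝓜 | LNaturalConvex 𝓜.objective ∧ LInftyLipschitz L 𝓜.objective ∧
    ∀ x, HasSubgaussianMGF (fun y => 𝓜.F x y - 𝓜.objective x) (σ ^ 2).toNNReal (𝓜.law x)}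

/-! ### Simulation algorithms, the PGS guarantee and the simulation cost -/

/-- A sequential simulation algorithm on `[N]^d`. Its rules see the outputs of the simulations
run so far (these outputs determine the systems that were simulated). `sample` is the sampling
rule, `halted` the stopping rule, and `recommend` the recommendation rule. -/
structure SimAlgorithm (d N : ℕ) where
  sample : (n : ℕ) → (Fin n → ℝ) → Grid d N
  halted : (n : ℕ) → Set (Fin n → ℝ)
  recommend : (n : ℕ) → (Fin n → ℝ) → Grid d N

namespace SimAlgorithm

variable {d N : ℕ}

/-- The three rules are measurable in the observed outputs. -/
def IsMeasurable (A : SimAlgorithm d N) : Prop :=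
  ∀ n, Measurable (A.sample n) ∧ MeasurableSet (A.halted n) ∧ Measurable (A.recommend n)

/-- The first `n` observed outputs, if the `k`-th simulation outputs `out k x` when it is run at
system `x`, and if the stopping rule is ignored. -/
def history (A : SimAlgorithm d N) (out : ℕ → Grid d N → ℝ) : (n : ℕ) → Fin n → ℝ
  | 0 => Fin.elim0
  | n + 1 => Fin.snoc (A.history out n) (out n (A.sample n (A.history out n)))

/-- The stopping time, which is the number of simulations that are run. -/
def stopTime (A : SimAlgorithm d N) (out : ℕ → Grid d N → ℝ) : ℕ∞ :=
  ⨅ (n : ℕ) (_ : A.history out n ∈ A.halted n), (n : ℕ∞)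

/-- The solution that the algorithm returns when it stops. -/
def result (A : SimAlgorithm d N) (out : ℕ → Grid d N → ℝ) : Grid d N :=
  A.recommend (A.stopTime out).toNat (A.history out (A.stopTime out).toNat)

/-- The solution returned for the model `𝓜` is an `(ε, δ)`-PGS solution: with probability at
least `1 - δ` its objective value is at most `ε` larger than the minimum. -/
def ReturnsPGS (A : SimAlgorithm d N) (𝓜 : SimModel.{u} d N) (ε δ : ℝ) : Prop :=
  ENNReal.ofReal (1 - δ) ≤
    𝓜.prob {ω | ∀ y, 𝓜.objective (A.result (𝓜.output ω)) ≤ 𝓜.objective y + ε}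

/-- `A` is an `((ε, δ)-PGS, 𝓒)`-algorithm: for every model of the class `𝓒` it stops almost
surely and returns an `(ε, δ)`-PGS solution. -/
def IsPGSAlgorithm (A : SimAlgorithm d N) (𝓒 : Set (SimModel.{u} d N)) (ε δ : ℝ) : Prop :=
  A.IsMeasurable ∧
    ∀ 𝓜 ∈ 𝓒, (∀ᵐ ω ∂𝓜.prob, A.stopTime (𝓜.output ω) < ⊤) ∧ A.ReturnsPGS 𝓜 ε δ

end SimAlgorithm

/-- The expected simulation cost of the `(ε, δ)`-PGS guarantee over the class `𝓒`: the infimum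
over all `((ε, δ)-PGS, 𝓒)`-algorithms of the largest expected number of simulations. -/
def expectedSimulationCost {d N : ℕ} (𝓒 : Set (SimModel.{u} d N)) (ε δ : ℝ) : ENNReal :=
  ⨅ (A : SimAlgorithm d N) (_ : A.IsPGSAlgorithm 𝓒 ε δ),
    ⨆ 𝓜 ∈ 𝓒, ∫⁻ ω, ((A.stopTime (𝓜.output ω) : ℕ∞) : ENNReal) ∂𝓜.prob

/-! ### Neighbouring points for the piecewise Lovász extension -/

/-- The corner `y ∈ [N-1]^d` of a cube `y + [0,1]^d` that contains `x ∈ [1,N]^d`, coordinatewise: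
`⌊t⌋`, or `N - 1` if `t = N`. -/
def cubeCorner (N : ℕ) (t : ℝ) : ℤ := max 1 (min ⌊t⌋ ((N : ℤ) - 1))

/-- A consistent permutation of `x` in its cube: it lists the coordinates of `x - y` in
nonincreasing order. -/
def consistentPerm (N : ℕ) {d : ℕ} (x : Fin d → ℝ) : Equiv.Perm (Fin d) :=
  Tuple.sort fun k => -(x k - (cubeCorner N (x k) : ℝ))

/-- The `i`-th neighbouring point `S^{x,i} = y + ∑_{j ≤ i} e_{α_x(j)}` of `x`, for
`i = 0, …, d`. -/
def neighbor {N : ℕ} (hN : 2 ≤ N) {d : ℕ} (x : Fin d → ℝ) (i : ℕ) : Grid d N := fun k =>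
  ⟨cubeCorner N (x k) + if ((consistentPerm N x).symm k : ℕ) < i then 1 else 0, by
    unfold cubeCorner
    simp only [Set.mem_Icc]
    split_ifs <;> omega⟩

/-! ### Projected and truncated stochastic subgradient descent -/

/-- The stochastic subgradient at `x` in iteration `t`, in terms of the simulation outputs
`z 0, z 1, …`. Its component `α_x(i)`, for `i = 1, …, d`, is an output at `S^{x,i}` minus an
output at `S^{x,i-1}`; each iteration runs `2 d` fresh simulations. -/
def stochSubgrad (N : ℕ) {d : ℕ} (z : ℕ → ℝ) (t : ℕ) (x : Fin d → ℝ) : Fin d → ℝ := fun k =>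
  z (2 * d * t + 2 * ((consistentPerm N x).symm k : ℕ)) -
    z (2 * d * t + 2 * ((consistentPerm N x).symm k : ℕ) + 1)

/-- The iterates `x^0 = (N/2, …, N/2)`, `x^{t+1} = P(x^t - η T_M(ĝ^t))`, with the truncation
`T_M(a) = (a ∧ M) ∨ (-M)` and the projection `P(a) = (a ∧ N) ∨ 1`, applied componentwise. -/
def ssgdIterate (d N : ℕ) (M η : ℝ) (z : ℕ → ℝ) : ℕ → Fin d → ℝ
  | 0 => fun _ => (N : ℝ) / 2
  | t + 1 => fun k =>
      max (min (ssgdIterate d N M η z t k -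
        η * max (min (stochSubgrad N z t (ssgdIterate d N M η z t) k) M) (-M)) N) 1

/-- The averaging point `(x^0 + ⋯ + x^{T-1}) / T`. -/
def ssgdAverage (d N T : ℕ) (M η : ℝ) (z : ℕ → ℝ) : Fin d → ℝ := fun k =>
  (∑ t ∈ Finset.range T, ssgdIterate d N M η z t k) / T

/-- The number of simulations of each neighbouring point in the rounding step: the least `n` for
which the half-width `σ √(2 log(8/δ) / n)` of the `1 - δ/4` Hoeffding confidence interval for the
mean of `n` outputs is at most `ε/4`. -/
def roundingSize (σ ε δ : ℝ) : ℕ := ⌈32 * σ ^ 2 / ε ^ 2 * Real.log (8 / δ)⌉₊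

/-- The first index at which `v` is minimal. -/
def argminIndex {m : ℕ} (v : Fin (m + 1) → ℝ) : Fin (m + 1) :=
  (Finset.univ.filter fun i => ∀ j, v i ≤ v j).min' <| by
    obtain ⟨i, hi⟩ := Finite.exists_min v
    exact ⟨i, by simpa using hi⟩

/-- Projected and truncated stochastic subgradient descent with `T` iterations, truncation
threshold `M` and step size `η`, followed by the rounding of the averaging point to that one of
its `d + 1` neighbouring points that has the smallest empirical mean.
Simulations `2dt + 2i` and `2dt + 2i + 1` (`t < T`, `i < d`) are run at `S^{x^t, i+1}` and
`S^{x^t, i}`; simulations `2dT + i n, …, 2dT + i n + n - 1` (`i ≤ d`) at the neighbouring point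
`i` of the averaging point. -/
def ssgd {d N : ℕ} (hN : 2 ≤ N) (σ ε δ : ℝ) (T : ℕ) (M η : ℝ) : SimAlgorithm d N where
  sample m h :=
    let z : ℕ → ℝ := fun j => if hj : j < m then h ⟨j, hj⟩ else 0
    if m < 2 * d * T then
      let i := m % (2 * d) / 2
      neighbor hN (ssgdIterate d N M η z (m / (2 * d))) (if m % 2 = 0 then i + 1 else i)
    else
      neighbor hN (ssgdAverage d N T M η z) ((m - 2 * d * T) / roundingSize σ ε δ)
  halted m := {_h | 2 * d * T + (d + 1) * roundingSize σ ε δ ≤ m}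
  recommend m h :=
    let z : ℕ → ℝ := fun j => if hj : j < m then h ⟨j, hj⟩ else 0
    let n := roundingSize σ ε δ
    neighbor hN (ssgdAverage d N T M η z)
      (argminIndex (m := d) fun i =>
        (∑ j ∈ Finset.range n, z (2 * d * T + i * n + j)) / n)

end

/-! ### Discrete convexity: the piecewise Lovász extension and its subgradients. -/

section DiscreteConvexity

variable {d N : ℕ}

/-! Along the chain of neighbours of a point, `f` has an affine interpolant with gradient
`lovaszGrad`. Subtracting it leaves an L♮-convex function that vanishes on the chain, and such a
function is nonnegative on the whole grid (`LNaturalConvex.nonneg_of_chain`). Hence the chain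
slopes, which `2d` simulations estimate, are a global subgradient (`lovaszExt_add_le_apply`,
`lovaszExt_add_le`). The extension at a point is a convex combination of the values at its
neighbours, so one neighbour is at least as good as the point (`exists_neighbor_le_lovaszExt`).

Projected descent is analysed coordinate by coordinate. Truncated gradients are bounded by `M`, so
the deterministic part of the regret is at most `d N M √T`. What remains is a sum of `d T` noise
terms: the deviation of an iterate from the minimiser in one coordinate, at most `N`, times the
error of one truncated difference (`ssgdAverage_error_le`). By symmetrization a truncated difference
stays sub-Gaussian about its mean at the cost of a constant factor, and for `M ≥ L + K` its bias
decays like a Gaussian tail in `K`. An exponential supermartingale then bounds the failure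
probability by `exp (-T ε² / (512 σ² N² d))` (`ssgd_descent_tail`).

The noise therefore needs only `T ≳ d N² / ε² * log (1/δ)`. The regret needs `T ≥ 16 d² N² M² / ε²`,
where `δ` enters only through the `log T` inside `M`. This separation gives the `log (1/δ)` term of
the cost `d²` rather than `d³`. Regret and noise contribute `ε/4` each and rounding `ε/2`; rounding
compares each bad neighbour directly with the best one (`ssgd_rounding_tail`), which gives a squared
failure probability. The choice of `T` is circular, since `T` must dominate `M²` and `M²` contains
`log T`; `exists_iteration_constant` and `regret_le_of_iterations` resolve this. -/

theorem LNaturalConvex.sub_affine {f : Grid d N → ℝ} (hf : LNaturalConvex f) (c : ℝ)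
    (g a : Fin d → ℝ) :
    LNaturalConvex fun q => f q - (c + ∑ k, g k * (((q k : ℤ) : ℝ) - a k)) := by
  intro x y
  have h := hf x y
  have key : ∑ k, g k * ((((x.midCeil y) k : ℤ) : ℝ) - a k) +
      ∑ k, g k * ((((x.midFloor y) k : ℤ) : ℝ) - a k) =
      ∑ k, g k * (((x k : ℤ) : ℝ) - a k) + ∑ k, g k * (((y k : ℤ) : ℝ) - a k) := by
    rw [← Finset.sum_add_distrib, ← Finset.sum_add_distrib]
    refine Finset.sum_congr rfl fun k _ => ?_
    have h1 : ((x.midCeil y k : ℤ)) + (x.midFloor y k : ℤ) = (x k : ℤ) + (y k : ℤ) := by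
      simp only [Grid.midCeil, Grid.midFloor]; omega
    have h2 : (((x.midCeil y k : ℤ)) : ℝ) + ((x.midFloor y k : ℤ) : ℝ) =
        ((x k : ℤ) : ℝ) + ((y k : ℤ) : ℝ) := by exact_mod_cast h1
    linear_combination g k * h2
  simp only
  linarith

/-- A submodular function on a unit cube that vanishes on a maximal chain is nonnegative. -/
theorem LNaturalConvex.nonneg_on_cube {h : Grid d N → ℝ} (hh : LNaturalConvex h)
    (α : Equiv.Perm (Fin d)) (S : ℕ → Grid d N) (p : Fin d → ℤ)
    (hS : ∀ i k, (S i k : ℤ) = p k + if (α.symm k : ℕ) < i then 1 else 0)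
    (h0 : ∀ i ≤ d, h (S i) = 0) (q : Grid d N)
    (hq : ∀ k, (q k : ℤ) = p k ∨ (q k : ℤ) = p k + 1) : 0 ≤ h q := by
  have main : ∀ i ≤ d, ∀ q : Grid d N, (∀ k, (q k : ℤ) = p k ∨ (q k : ℤ) = p k + 1) →
      (∀ k, i ≤ (α.symm k : ℕ) → (q k : ℤ) = p k) → 0 ≤ h q := by
    intro i
    induction i with
    | zero =>
      intro _ q _ hq'
      have : q = S 0 := by
        funext k
        apply Subtype.ext
        rw [hS, hq' k (Nat.zero_le _)]; simp
      rw [this, h0 0 (Nat.zero_le _)]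
    | succ i ih =>
      intro hi q hq hq'
      have hk : ∀ k, (α.symm k : ℕ) = i → k = α ⟨i, hi⟩ := by
        intro k hk
        rw [← Equiv.symm_apply_eq]
        exact Fin.ext hk
      have hk' : ((α.symm (α ⟨i, hi⟩)) : ℕ) = i := by simp
      rcases hq (α ⟨i, hi⟩) with hqi | hqi
      · refine ih (by omega) q hq fun k hki => ?_
        rcases hki.eq_or_lt with e | e
        · rw [hk k e.symm]; exact hqi
        · exact hq' k e
      -- Inside a unit cube the rounded midpoints are join and meet. The join of `q` with `S i` is
      -- the next chain point, and the meet falls under the induction hypothesis.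
      · have e1 : q.midCeil (S i) = S (i + 1) := by
          funext k
          apply Subtype.ext
          simp only [Grid.midCeil, hS]
          rcases lt_trichotomy (α.symm k : ℕ) i with e | e | e
          · rcases hq k with e' | e' <;> rw [if_pos e, if_pos (by omega)] <;> omega
          · rw [if_neg (by omega), if_pos (by omega)]
            have := hk k e
            subst this
            omega
          · have := hq' k e
            rw [if_neg (by omega), if_neg (by omega)]
            omega
        have e2 : 0 ≤ h (q.midFloor (S i)) := by
          refine ih (by omega) _ (fun k => ?_) (fun k hki => ?_)
          · simp only [Grid.midFloor, hS]
            have := hq k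
            split_ifs <;> omega
          · simp only [Grid.midFloor, hS]
            have := hq k
            rw [if_neg (by omega)]
            omega
        have := hh q (S i)
        rw [e1, h0 _ hi, h0 i (by omega)] at this
        linarith
  exact main d le_rfl q hq fun k hk => absurd (α.symm k).2 (by omega)

/-- An `L♮`-convex function that vanishes on a maximal chain of a unit cube is nonnegative. -/
theorem LNaturalConvex.nonneg_of_chain {h : Grid d N → ℝ} (hh : LNaturalConvex h)
    (α : Equiv.Perm (Fin d)) (S : ℕ → Grid d N) (p : Fin d → ℤ)
    (hS : ∀ i k, (S i k : ℤ) = p k + if (α.symm k : ℕ) < i then 1 else 0)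
    (h0 : ∀ i ≤ d, h (S i) = 0) (q : Grid d N) : 0 ≤ h q := by
  have main : ∀ r : ℕ, ∀ q : Grid d N, (∀ k, |(q k : ℤ) - p k| ≤ r + 1) → 0 ≤ h q := by
    intro r
    induction r using Nat.strong_induction_on with
    | _ r ih =>
      intro q hq
      -- The midpoints with `p` halve the distance up to rounding, which is a gain only if the
      -- distance exceeds 1. At distance 1 the midpoints are taken with the top corner `S d`
      -- instead; both roundings then lie in the cube.
      rcases Nat.eq_zero_or_pos r with rfl | hr
      · have hd : ∀ k, (S d k : ℤ) = p k + 1 := fun k => by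
          rw [hS, if_pos (α.symm k).2]
        have e1 : 0 ≤ h (q.midCeil (S d)) := hh.nonneg_on_cube α S p hS h0 _ fun k => by
          have := hq k
          rw [abs_le] at this
          simp only [Grid.midCeil, hd]
          push_cast at this
          omega
        have e2 : 0 ≤ h (q.midFloor (S d)) := hh.nonneg_on_cube α S p hS h0 _ fun k => by
          have := hq k
          rw [abs_le] at this
          simp only [Grid.midFloor, hd]
          push_cast at this
          omega
        have := hh q (S d)
        rw [h0 d le_rfl] at this
        linarith
      · have hz : ∀ k, (S 0 k : ℤ) = p k := fun k => by rw [hS]; simp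
        have e1 : 0 ≤ h (q.midCeil (S 0)) := ih (r - 1) (by omega) _ fun k => by
          have := hq k
          rw [abs_le] at this ⊢
          simp only [Grid.midCeil, hz]
          omega
        have e2 : 0 ≤ h (q.midFloor (S 0)) := ih (r - 1) (by omega) _ fun k => by
          have := hq k
          rw [abs_le] at this ⊢
          simp only [Grid.midFloor, hz]
          omega
        have := hh q (S 0)
        rw [h0 0 (Nat.zero_le _)] at this
        linarith
  refine main (∑ k, ((q k : ℤ) - p k).natAbs) q fun k => ?_
  have : ((q k : ℤ) - p k).natAbs ≤ ∑ k, ((q k : ℤ) - p k).natAbs :=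
    Finset.single_le_sum (f := fun k => ((q k : ℤ) - p k).natAbs) (fun _ _ => Nat.zero_le _)
      (Finset.mem_univ k)
  rw [Int.abs_eq_natAbs]
  omega

theorem neighbor_coe (hN : 2 ≤ N) (x : Fin d → ℝ) (i : ℕ) (k : Fin d) :
    (neighbor hN x i k : ℤ) =
      cubeCorner N (x k) + if ((consistentPerm N x).symm k : ℕ) < i then 1 else 0 := rfl

theorem abs_objective_neighbor_succ_sub_le {L : ℝ} {f : Grid d N → ℝ} (hf : LInftyLipschitz L f)
    (hN : 2 ≤ N) (x : Fin d → ℝ) (i : ℕ) :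
    |f (neighbor hN x (i + 1)) - f (neighbor hN x i)| ≤ L := by
  refine hf _ _ fun k => ?_
  simp only [neighbor_coe]
  rw [abs_le]
  split_ifs <;> omega

/-- The slopes of `f` along the chain of neighbouring points of `x`. -/
noncomputable def lovaszGrad (hN : 2 ≤ N) (f : Grid d N → ℝ) (x : Fin d → ℝ) (k : Fin d) : ℝ :=
  f (neighbor hN x ((consistentPerm N x).symm k + 1)) -
    f (neighbor hN x ((consistentPerm N x).symm k))

/-- The piecewise Lovász extension of `f`. -/
noncomputable def lovaszExt (hN : 2 ≤ N) (f : Grid d N → ℝ) (x : Fin d → ℝ) : ℝ :=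
  f (neighbor hN x 0) + ∑ k, lovaszGrad hN f x k * (x k - cubeCorner N (x k))

/-- Listed in the order of the chain, the slopes telescope. This is what makes the affine
interpolant agree with `f` at every chain point. -/
theorem sum_lovaszGrad_mul_ite (hN : 2 ≤ N) (f : Grid d N → ℝ) (x : Fin d → ℝ) :
    ∀ i ≤ d, ∑ k, lovaszGrad hN f x k *
      (if ((consistentPerm N x).symm k : ℕ) < i then (1 : ℝ) else 0) =
      f (neighbor hN x i) - f (neighbor hN x 0) := by
  intro i hi
  rw [← Equiv.sum_comp (consistentPerm N x)]
  simp only [lovaszGrad, Equiv.symm_apply_apply]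
  rw [Fin.sum_univ_eq_sum_range (fun j => (f (neighbor hN x (j + 1)) - f (neighbor hN x j)) *
    (if j < i then (1 : ℝ) else 0)) d, ← Finset.sum_range_sub (fun j => f (neighbor hN x j)) i]
  simp only [mul_ite, mul_one, mul_zero]
  rw [← Finset.sum_filter]
  refine Finset.sum_congr ?_ fun _ _ => rfl
  ext j
  simp only [Finset.mem_filter, Finset.mem_range]
  omega

/-- The difference of the two sides is L♮-convex in `q` and vanishes on the chain of `x`, so
`LNaturalConvex.nonneg_of_chain` applies to all grid points, not only to those in the cube of `x`.
-/
theorem lovaszExt_add_le_apply (hN : 2 ≤ N) {f : Grid d N → ℝ} (hf : LNaturalConvex f)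
    (x : Fin d → ℝ) (q : Grid d N) :
    lovaszExt hN f x + ∑ k, lovaszGrad hN f x k * (((q k : ℤ) : ℝ) - x k) ≤ f q := by
  have key := (hf.sub_affine (lovaszExt hN f x) (lovaszGrad hN f x) x).nonneg_of_chain
    (consistentPerm N x) (fun i => neighbor hN x i) (fun k => cubeCorner N (x k))
    (fun i k => rfl) (fun i hi => by
      simp only [lovaszExt, neighbor_coe, add_assoc, ← Finset.sum_add_distrib]
      have h2 := sum_lovaszGrad_mul_ite hN f x i hi
      have h3 : ∀ k, (lovaszGrad hN f x k * (x k - cubeCorner N (x k)) + lovaszGrad hN f x k *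
        (((cubeCorner N (x k) + if ((consistentPerm N x).symm k : ℕ) < i then (1 : ℤ) else 0 : ℤ)
          : ℝ) - x k)) = lovaszGrad hN f x k *
          (if ((consistentPerm N x).symm k : ℕ) < i then (1 : ℝ) else 0) := by
        intro k
        push_cast
        ring
      simp only [h3, h2]
      ring) q
  linarith

/-- Abel summation turns the right side into `a n * v n` plus the terms `a i * (v i - v (i + 1))`,
which are nonnegative and dropped. -/
theorem abel_sum_ge (a v : ℕ → ℝ) (n : ℕ) (ha : ∀ i ≤ n, 0 ≤ a i) (hv0 : v 0 = 1)
    (hv : ∀ i < n, v (i + 1) ≤ v i) :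
    a n * v n ≤ a 0 + ∑ j ∈ Finset.range n, (a (j + 1) - a j) * v (j + 1) := by
  induction n with
  | zero => simp [hv0]
  | succ n ih =>
    rw [Finset.sum_range_succ]
    have h1 := ih (fun i hi => ha i (by omega)) (fun i hi => hv i (by omega))
    nlinarith [mul_nonneg (ha n (by omega)) (sub_nonneg.2 (hv n (by omega)))]

theorem sub_cubeCorner_mem (hN : 2 ≤ N) {t : ℝ} (ht : t ∈ Set.Icc (1 : ℝ) N) :
    t - cubeCorner N t ∈ Set.Icc (0 : ℝ) 1 := by
  have hN' : (2 : ℤ) ≤ N := by exact_mod_cast hN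
  have h1 : 1 ≤ ⌊t⌋ := Int.le_floor.2 (by simpa using ht.1)
  have h2 : ((⌊t⌋ : ℤ) : ℝ) ≤ t := Int.floor_le t
  have h3 : t < (⌊t⌋ : ℝ) + 1 := Int.lt_floor_add_one t
  have h4 := ht.2
  rcases le_total ⌊t⌋ ((N : ℤ) - 1) with h | h
  · have : cubeCorner N t = ⌊t⌋ := by unfold cubeCorner; omega
    rw [this]; constructor <;> linarith
  · have : cubeCorner N t = (N : ℤ) - 1 := by unfold cubeCorner; omega
    rw [this]
    have h5 : (((N : ℤ) - 1 : ℤ) : ℝ) ≤ (⌊t⌋ : ℝ) := by exact_mod_cast h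
    push_cast at h5 ⊢
    constructor <;> linarith

/-- The extension is a convex combination of the values at the neighbours, with the gaps between
consecutive sorted fractional parts as weights. No convexity of `h` is involved. -/
theorem lovaszExt_nonneg (hN : 2 ≤ N) {h : Grid d N → ℝ} {x : Fin d → ℝ}
    (hx : ∀ k, x k ∈ Set.Icc (1 : ℝ) N) (hh : ∀ i ≤ d, 0 ≤ h (neighbor hN x i)) :
    0 ≤ lovaszExt hN h x := by
  set α := consistentPerm N x with hα
  set w : Fin d → ℝ := fun k => x k - cubeCorner N (x k) with hw
  have hmono : Monotone ((fun k => -(x k - (cubeCorner N (x k) : ℝ))) ∘ α) :=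
    Tuple.monotone_sort _
  -- The fractional parts in decreasing order, shifted by one and preceded by `1`. The value `0`
  -- beyond index `d` is never used.
  let v : ℕ → ℝ := fun j => if j = 0 then 1 else if hj : j - 1 < d then w (α ⟨j - 1, hj⟩) else 0
  have hw01 : ∀ k, w k ∈ Set.Icc (0 : ℝ) 1 := fun k => sub_cubeCorner_mem hN (hx k)
  have hv : ∀ j (hj : j < d), v (j + 1) = w (α ⟨j, hj⟩) := by
    intro j hj
    simp [v, hj]
  have key := abel_sum_ge (fun i => h (neighbor hN x i)) v d hh (by simp [v]) (by
    intro i hi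
    rw [hv i hi]
    rcases i with _ | i
    · simpa [v] using (hw01 _).2
    · rw [hv i (by omega)]
      have := hmono (show (⟨i, by omega⟩ : Fin d) ≤ ⟨i + 1, hi⟩ from by simp)
      simp only [Function.comp] at this
      simp only [hw]
      linarith)
  have e : lovaszExt hN h x = h (neighbor hN x 0) + ∑ j ∈ Finset.range d,
      (h (neighbor hN x (j + 1)) - h (neighbor hN x j)) * v (j + 1) := by
    rw [lovaszExt, ← Equiv.sum_comp α, ← Fin.sum_univ_eq_sum_range
      (fun j => (h (neighbor hN x (j + 1)) - h (neighbor hN x j)) * v (j + 1))]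
    congr 1
    refine Finset.sum_congr rfl fun j _ => ?_
    rw [hv j j.2]
    simp [lovaszGrad, ← hα, hw]
  rw [e]
  refine le_trans (mul_nonneg (hh d le_rfl) ?_) key
  rcases d with _ | d
  · simp [v]
  · rw [hv d (by omega)]; exact (hw01 _).1

/-- The extension is linear in `f` and reproduces affine functions, because each chain step raises
exactly one coordinate by one. -/
theorem lovaszExt_sub_affine (hN : 2 ≤ N) (f : Grid d N → ℝ) (c : ℝ) (g a x : Fin d → ℝ) :
    lovaszExt hN (fun q => f q - (c + ∑ k, g k * (((q k : ℤ) : ℝ) - a k))) x =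
      lovaszExt hN f x - (c + ∑ k, g k * (x k - a k)) := by
  have hg : ∀ k, lovaszGrad hN (fun q => f q - (c + ∑ k, g k * (((q k : ℤ) : ℝ) - a k))) x k =
      lovaszGrad hN f x k - g k := by
    intro k
    simp only [lovaszGrad]
    have : ∑ l, g l * (((neighbor hN x ((consistentPerm N x).symm k + 1) l : ℤ) : ℝ) - a l) -
        ∑ l, g l * (((neighbor hN x ((consistentPerm N x).symm k) l : ℤ) : ℝ) - a l) = g k := by
      rw [← Finset.sum_sub_distrib, Finset.sum_eq_single k]
      · simp only [neighbor_coe]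
        simp
        ring
      · intro l _ hl
        have : ((consistentPerm N x).symm l : ℕ) ≠ ((consistentPerm N x).symm k : ℕ) :=
          fun h => hl ((consistentPerm N x).symm.injective (Fin.ext h))
        simp only [neighbor_coe]
        by_cases h : ((consistentPerm N x).symm l : ℕ) < ((consistentPerm N x).symm k : ℕ)
        · rw [if_pos (by omega), if_pos h]; ring
        · rw [if_neg (by omega), if_neg h]; ring
      · simp
    linarith
  simp only [lovaszExt, hg]
  have : ∀ k, g k * (((neighbor hN x 0 k : ℤ) : ℝ) - a k) =
      g k * (x k - a k) - g k * (x k - cubeCorner N (x k)) := by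
    intro k
    rw [neighbor_coe]
    simp
    ring
  simp only [this, sub_mul, Finset.sum_sub_distrib]
  ring

/-- `lovaszGrad` is a subgradient of the piecewise Lovász extension. -/
theorem lovaszExt_add_le (hN : 2 ≤ N) {f : Grid d N → ℝ} (hf : LNaturalConvex f)
    (x : Fin d → ℝ) {y : Fin d → ℝ} (hy : ∀ k, y k ∈ Set.Icc (1 : ℝ) N) :
    lovaszExt hN f x + ∑ k, lovaszGrad hN f x k * (y k - x k) ≤ lovaszExt hN f y := by
  have := lovaszExt_nonneg hN (h := fun q => f q - (lovaszExt hN f x +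
    ∑ k, lovaszGrad hN f x k * (((q k : ℤ) : ℝ) - x k))) hy
    (fun i _ => sub_nonneg.2 (lovaszExt_add_le_apply hN hf x _))
  rw [lovaszExt_sub_affine] at this
  linarith

/-- Applied with `m` the least value among the neighbours, this shows that exact rounding to the
best neighbour does not increase the objective. -/
theorem exists_neighbor_le_lovaszExt (hN : 2 ≤ N) (f : Grid d N → ℝ) {x : Fin d → ℝ}
    (hx : ∀ k, x k ∈ Set.Icc (1 : ℝ) N) {m : ℝ}
    (hm : ∀ i ≤ d, m ≤ f (neighbor hN x i)) : m ≤ lovaszExt hN f x := by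
  have := lovaszExt_nonneg hN (h := fun q => f q - (m + ∑ k, (0 : Fin d → ℝ) k *
    (((q k : ℤ) : ℝ) - x k))) hx (fun i hi => by simpa using hm i hi)
  rw [lovaszExt_sub_affine] at this
  simp at this
  linarith

end DiscreteConvexity

/-! ### Truncated sub-Gaussian variables: concentration and bias. -/

section Truncation

open scoped NNReal ENNReal

/-- The truncation of `a` to the interval `[-M, M]`. -/
noncomputable def truncate (M a : ℝ) : ℝ := max (min a M) (-M)

theorem abs_truncate_le {M : ℝ} (hM : 0 ≤ M) (a : ℝ) : |truncate M a| ≤ M :=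
  abs_le.2 ⟨le_max_right _ _, max_le (min_le_right _ _) (by linarith)⟩

theorem abs_truncate_sub_le (M a b : ℝ) : |truncate M a - truncate M b| ≤ |a - b| := by
  unfold truncate
  exact (abs_max_sub_max_le_abs _ _ _).trans (abs_min_sub_min_le_max a M b M |>.trans (by simp))

theorem measurable_truncate (M : ℝ) : Measurable (truncate M) := by
  unfold truncate; fun_prop

/-- Truncation only acts when `|a| > M ≥ L + K`, which forces `|a - g| > K`; the part cut off, `|a|
- M`, is then at most `|a - g| - K`. -/
theorem abs_truncate_sub_self_le {M L K g a : ℝ} (hg : |g| ≤ L) (hM : L + K ≤ M) (hM0 : 0 ≤ M) :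
    |truncate M a - a| ≤ max (|a - g| - K) 0 := by
  have h1 : |a| ≤ |a - g| + |g| := by simpa using abs_add_le (a - g) g
  have h2 := abs_le.1 h1
  unfold truncate
  rcases le_total a M with h | h
  · rcases le_total (-M) a with h' | h'
    · rw [min_eq_left h, max_eq_left h']; simp
    · rw [min_eq_left h, max_eq_right h', abs_le]
      constructor
      · linarith [le_max_right (|a - g| - K) 0]
      · exact le_trans (by linarith [h2.1]) (le_max_left _ _)
  · rw [min_eq_right h, max_eq_left (by linarith), abs_le]
    constructor
    · linarith [h2.2, le_max_left (|a - g| - K) 0]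
    · linarith [le_max_right (|a - g| - K) 0]

variable {Ω : Type*} [MeasurableSpace Ω] {μ : Measure Ω} [IsProbabilityMeasure μ]

theorem ProbabilityTheory.HasSubgaussianMGF.integrable_of_sub_const {W : Ω → ℝ} {g : ℝ} {c : ℝ≥0}
    (h : HasSubgaussianMGF (fun ω => W ω - g) c μ) : Integrable W μ :=
  (h.integrable.add (integrable_const g)).congr (Filter.Eventually.of_forall fun ω => by simp)

/-- A bounded contraction of a sub-Gaussian random variable is sub-Gaussian about its mean. -/
theorem integral_exp_contraction_le {W : Ω → ℝ} (hW : Measurable W) {g : ℝ} {c : ℝ≥0}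
    (h : HasSubgaussianMGF (fun ω => W ω - g) c μ) {φ : ℝ → ℝ} (hφ : Measurable φ)
    {B : ℝ} (hB : ∀ a, |φ a| ≤ B) (hLip : ∀ a b, |φ a - φ b| ≤ |a - b|) (s : ℝ) :
    ∫ ω, Real.exp (s * (φ (W ω) - ∫ ω', φ (W ω') ∂μ)) ∂μ ≤ Real.exp (c * s ^ 2) := by
  have hint : Integrable (fun ω => φ (W ω)) μ :=
    Integrable.of_bound (hφ.comp hW).aestronglyMeasurable B (Filter.Eventually.of_forall
      fun ω => hB _)
  have hbd : ∀ r a b : ℝ, ‖Real.exp (r * (φ a - φ b))‖ ≤ Real.exp (|r| * (B + B)) := by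
    intro r a b
    rw [Real.norm_eq_abs, Real.abs_exp]
    refine Real.exp_le_exp.2 ((le_abs_self _).trans ?_)
    rw [abs_mul]
    have := (abs_sub (φ a) (φ b)).trans (add_le_add (hB a) (hB b))
    gcongr
  have hmeas : ∀ r : ℝ, Measurable fun p : Ω × Ω => Real.exp (r * (φ (W p.1) - φ (W p.2))) := by
    intro r; fun_prop
  have hI : ∀ r : ℝ, Integrable (fun p : Ω × Ω => Real.exp (r * (φ (W p.1) - φ (W p.2))))
      (μ.prod μ) := fun r =>
    Integrable.of_bound (hmeas r).aestronglyMeasurable _ (Filter.Eventually.of_forall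
      fun p => hbd r _ _)
  have hY : ∀ r : ℝ, Integrable (fun p : Ω × Ω => Real.exp (r * (W p.1 - W p.2))) (μ.prod μ) ∧
      ∫ p, Real.exp (r * (W p.1 - W p.2)) ∂(μ.prod μ) ≤ Real.exp (c * r ^ 2) := by
    intro r
    have e : (fun p : Ω × Ω => Real.exp (r * (W p.1 - W p.2))) =
        fun p : Ω × Ω => Real.exp (r * (W p.1 - g)) * Real.exp (-r * (W p.2 - g)) := by
      funext p
      rw [← Real.exp_add]
      ring_nf
    rw [e]
    refine ⟨(h.integrable_exp_mul r).mul_prod (h.integrable_exp_mul (-r)), ?_⟩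
    rw [integral_prod_mul (fun ω => Real.exp (r * (W ω - g)))
      (fun ω => Real.exp (-r * (W ω - g)))]
    have h1 := h.mgf_le r
    have h2 := h.mgf_le (-r)
    unfold mgf at h1 h2
    refine (mul_le_mul h1 h2 (integral_nonneg fun _ => (Real.exp_pos _).le)
      (Real.exp_pos _).le).trans (le_of_eq ?_)
    rw [← Real.exp_add]
    ring_nf
  -- Symmetrization: by Jensen the mean may be replaced by an independent copy. The contraction
  -- property can only be used on differences `φ a - φ b`, which is why the copy is needed.
  have step1 : ∀ ω, Real.exp (s * (φ (W ω) - ∫ ω', φ (W ω') ∂μ)) ≤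
      ∫ ω', Real.exp (s * (φ (W ω) - φ (W ω'))) ∂μ := by
    intro ω
    have hi2 : Integrable (fun ω' => s * (φ (W ω) - φ (W ω'))) μ :=
      ((integrable_const _).sub hint).const_mul s
    have := convexOn_exp.map_integral_le (μ := μ) (f := fun ω' => s * (φ (W ω) - φ (W ω')))
      Real.continuous_exp.continuousOn isClosed_univ (by simp) hi2
      (Integrable.of_bound (by
        exact (Real.measurable_exp.comp ((measurable_const.sub (hφ.comp hW)).const_mul
          s)).aestronglyMeasurable) (Real.exp (|s| * (B + B)))
        (Filter.Eventually.of_forall fun ω' => hbd s _ _))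
    rwa [integral_const_mul, integral_sub (integrable_const _) hint, integral_const,
      probReal_univ, one_smul] at this
  have step2 : ∫ ω, Real.exp (s * (φ (W ω) - ∫ ω', φ (W ω') ∂μ)) ∂μ ≤
      ∫ p, Real.exp (s * (φ (W p.1) - φ (W p.2))) ∂(μ.prod μ) := by
    rw [integral_prod _ (hI s)]
    exact integral_mono_of_nonneg (Filter.Eventually.of_forall fun _ => (Real.exp_pos _).le)
      (hI s).integral_prod_left (Filter.Eventually.of_forall step1)
  have step3 : ∫ p, Real.exp (s * (φ (W p.1) - φ (W p.2))) ∂(μ.prod μ) =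
      ∫ p, Real.exp (-s * (φ (W p.1) - φ (W p.2))) ∂(μ.prod μ) := by
    rw [← integral_prod_swap (μ := μ) (ν := μ)
      (fun p : Ω × Ω => Real.exp (s * (φ (W p.1) - φ (W p.2))))]
    congr 1
    funext p
    simp only [Prod.fst_swap, Prod.snd_swap]
    ring_nf
  -- The symmetrized moment is the mean of a hyperbolic cosine, which is monotone in the absolute
  -- value of its argument, so the contraction can be removed. The copy doubles the variance proxy.
  have step4 : ∀ p : Ω × Ω, Real.exp (s * (φ (W p.1) - φ (W p.2))) +
      Real.exp (-s * (φ (W p.1) - φ (W p.2))) ≤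
      Real.exp (s * (W p.1 - W p.2)) + Real.exp (-s * (W p.1 - W p.2)) := by
    intro p
    have := Real.cosh_le_cosh.2 (show |s * (φ (W p.1) - φ (W p.2))| ≤ |s * (W p.1 - W p.2)| by
      rw [abs_mul, abs_mul]
      exact mul_le_mul_of_nonneg_left (hLip _ _) (abs_nonneg _))
    rw [Real.cosh_eq, Real.cosh_eq] at this
    simp only [neg_mul]
    linarith
  have step5 := integral_mono ((hI s).add (hI (-s))) ((hY s).1.add (hY (-s)).1) step4
  simp only [Pi.add_apply] at step5
  rw [integral_add (hI s) (hI (-s)), integral_add (hY s).1 (hY (-s)).1] at step5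
  have h1 := (hY s).2
  have h2 := (hY (-s)).2
  rw [neg_sq] at h2
  linarith

/-- The bias of the truncation of a sub-Gaussian random variable. -/
theorem abs_integral_truncate_sub_le {W : Ω → ℝ} (hW : Measurable W) {g : ℝ} {c : ℝ≥0}
    (hc : 0 < c) (h : HasSubgaussianMGF (fun ω => W ω - g) c μ) (hWg : ∫ ω, W ω ∂μ = g)
    {M L K : ℝ} (hg : |g| ≤ L) (hK : 0 < K) (hM : L + K ≤ M) :
    |∫ ω, truncate M (W ω) ∂μ - g| ≤ 2 * c / K * Real.exp (-K ^ 2 / (2 * c)) := by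
  have hL : 0 ≤ L := (abs_nonneg g).trans hg
  have hc' : (0 : ℝ) < c := hc
  have hM0 : 0 ≤ M := by linarith
  have hWi : Integrable W μ := h.integrable_of_sub_const
  have hti : Integrable (fun ω => truncate M (W ω)) μ :=
    Integrable.of_bound ((measurable_truncate M).comp hW).aestronglyMeasurable M
      (Filter.Eventually.of_forall fun ω => abs_truncate_le hM0 _)
  -- This `r` minimises the Chernoff exponent `-r K + c r² / 2`.
  set r : ℝ := K / c with hr
  have hr0 : 0 < r := by positivity
  have hpt : ∀ ω, |truncate M (W ω) - W ω| ≤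
      r⁻¹ * Real.exp (-(r * K)) * (Real.exp (r * (W ω - g)) + Real.exp (-r * (W ω - g))) := by
    intro ω
    refine (abs_truncate_sub_self_le hg hM hM0).trans ?_
    have h1 : max (|W ω - g| - K) 0 ≤ r⁻¹ * Real.exp (r * (|W ω - g| - K)) := by
      refine max_le ?_ (by positivity)
      rw [inv_mul_eq_div, le_div_iff₀ hr0]
      linarith [Real.add_one_le_exp (r * (|W ω - g| - K))]
    refine h1.trans ?_
    rw [mul_assoc]
    refine mul_le_mul_of_nonneg_left ?_ (by positivity)
    have e : Real.exp (r * (|W ω - g| - K)) = Real.exp (-(r * K)) * Real.exp (r * |W ω - g|) := by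
      rw [← Real.exp_add]; ring_nf
    rw [e]
    refine mul_le_mul_of_nonneg_left ?_ (Real.exp_pos _).le
    rcases abs_cases (W ω - g) with ⟨e, _⟩ | ⟨e, _⟩ <;> rw [e]
    · linarith [Real.exp_pos (-r * (W ω - g))]
    · rw [mul_neg, ← neg_mul]
      linarith [Real.exp_pos (r * (W ω - g))]
  have hbd : ∫ ω, |truncate M (W ω) - W ω| ∂μ ≤
      r⁻¹ * Real.exp (-(r * K)) * (Real.exp (c * r ^ 2 / 2) + Real.exp (c * r ^ 2 / 2)) := by
    refine (integral_mono (hti.sub hWi).abs (((h.integrable_exp_mul r).add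
      (h.integrable_exp_mul (-r))).const_mul _) hpt).trans ?_
    rw [integral_const_mul]
    refine mul_le_mul_of_nonneg_left ?_ (by positivity)
    simp only [Pi.add_apply]
    rw [integral_add (h.integrable_exp_mul r) (h.integrable_exp_mul (-r))]
    have h1 := h.mgf_le r
    have h2 := h.mgf_le (-r)
    rw [neg_sq] at h2
    exact add_le_add h1 h2
  calc |∫ ω, truncate M (W ω) ∂μ - g| = |∫ ω, (truncate M (W ω) - W ω) ∂μ| := by
        rw [integral_sub hti hWi, hWg]
    _ ≤ ∫ ω, |truncate M (W ω) - W ω| ∂μ := abs_integral_le_integral_abs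
    _ ≤ _ := hbd
    _ = 2 * c / K * Real.exp (-K ^ 2 / (2 * c)) := by
        have e1 : Real.exp (-(r * K)) * Real.exp (c * r ^ 2 / 2) =
            Real.exp (-K ^ 2 / (2 * c)) := by
          rw [← Real.exp_add, hr]
          congr 1
          field_simp
          ring
        rw [← e1, hr, inv_div]
        ring

/-- The error splits into the deterministic bias, which gives the term linear in `|s|`, and the
centred truncated variable, which gives the quadratic term. -/
theorem integral_exp_truncate_le {W : Ω → ℝ} (hW : Measurable W) {g : ℝ} {c : ℝ≥0}
    (hc : 0 < c) (h : HasSubgaussianMGF (fun ω => W ω - g) c μ) (hWg : ∫ ω, W ω ∂μ = g)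
    {M L K : ℝ} (hg : |g| ≤ L) (hK : 0 < K) (hM : L + K ≤ M) (s : ℝ) :
    ∫ ω, Real.exp (s * (g - truncate M (W ω))) ∂μ ≤
      Real.exp (c * s ^ 2 + |s| * (2 * c / K * Real.exp (-K ^ 2 / (2 * c)))) := by
  have hM0 : 0 ≤ M := by linarith [(abs_nonneg g).trans hg]
  have h1 := integral_exp_contraction_le hW h (measurable_truncate M) (abs_truncate_le hM0)
    (abs_truncate_sub_le M) (-s)
  have h2 := abs_integral_truncate_sub_le hW hc h hWg hg hK hM
  set m := ∫ ω, truncate M (W ω) ∂μ with hm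
  have e : (fun ω => Real.exp (s * (g - truncate M (W ω)))) =
      fun ω => Real.exp (s * (g - m)) * Real.exp (-s * (truncate M (W ω) - m)) := by
    funext ω
    rw [← Real.exp_add]
    ring_nf
  rw [e, integral_const_mul, add_comm, Real.exp_add]
  refine mul_le_mul ?_ (by simpa using h1) (integral_nonneg fun _ => (Real.exp_pos _).le)
    (Real.exp_pos _).le
  refine Real.exp_le_exp.2 ((le_abs_self _).trans ?_)
  rw [abs_mul, abs_sub_comm]
  exact mul_le_mul_of_nonneg_left h2 (abs_nonneg s)

/-- The exponential moment of the truncated difference of two independent sub-Gaussian random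
variables. -/
theorem lintegral_exp_truncate_sub_le {Y : Type*} [MeasurableSpace Y] {μ₁ μ₂ : Measure Y}
    [IsProbabilityMeasure μ₁] [IsProbabilityMeasure μ₂] {X₁ X₂ : Y → ℝ} (hX₁ : Measurable X₁)
    (hX₂ : Measurable X₂) {c : ℝ≥0} (hc : 0 < c)
    (h₁ : HasSubgaussianMGF (fun y => X₁ y - ∫ y, X₁ y ∂μ₁) c μ₁)
    (h₂ : HasSubgaussianMGF (fun y => X₂ y - ∫ y, X₂ y ∂μ₂) c μ₂)
    {M L K : ℝ} (hg : |∫ y, X₁ y ∂μ₁ - ∫ y, X₂ y ∂μ₂| ≤ L) (hK : 0 < K) (hM : L + K ≤ M)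
    (s : ℝ) :
    ∫⁻ y₁, ∫⁻ y₂, ENNReal.ofReal (Real.exp (s * (∫ y, X₁ y ∂μ₁ - ∫ y, X₂ y ∂μ₂ -
        truncate M (X₁ y₁ - X₂ y₂)))) ∂μ₂ ∂μ₁ ≤
      ENNReal.ofReal (Real.exp (2 * c * s ^ 2 +
        |s| * (4 * c / K * Real.exp (-K ^ 2 / (4 * c))))) := by
  have hi₁ : Integrable X₁ μ₁ := h₁.integrable_of_sub_const
  have hi₂ : Integrable X₂ μ₂ := h₂.integrable_of_sub_const
  set g₁ := ∫ y, X₁ y ∂μ₁ with hg₁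
  set g₂ := ∫ y, X₂ y ∂μ₂ with hg₂
  have hW : Measurable fun p : Y × Y => X₁ p.1 - X₂ p.2 := by fun_prop
  have hs1 : HasSubgaussianMGF (fun p : Y × Y => X₁ p.1 - g₁) c (μ₁.prod μ₂) := by
    have := HasSubgaussianMGF.of_map (μ := μ₁.prod μ₂) (Y := Prod.fst) (c := c)
      (X := fun y => X₁ y - g₁) measurable_fst.aemeasurable (by simpa using h₁)
    exact this
  have hs2 : HasSubgaussianMGF (fun p : Y × Y => X₂ p.2 - g₂) c (μ₁.prod μ₂) := by
    have := HasSubgaussianMGF.of_map (μ := μ₁.prod μ₂) (Y := Prod.snd) (c := c)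
      (X := fun y => X₂ y - g₂) measurable_snd.aemeasurable (by simpa using h₂)
    exact this
  have hind : IndepFun (fun p : Y × Y => X₁ p.1 - g₁) (fun p : Y × Y => X₂ p.2 - g₂)
      (μ₁.prod μ₂) :=
    indepFun_prod (hX₁.sub_const g₁) (hX₂.sub_const g₂)
  -- The difference of two outputs has parameter `c + c`, which explains the doubled constants in
  -- the conclusion.
  have hsub := hs1.sub_of_indepFun hs2 hind
  have hsub' : HasSubgaussianMGF (fun p : Y × Y => (X₁ p.1 - X₂ p.2) - (g₁ - g₂)) (c + c)
      (μ₁.prod μ₂) := by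
    refine hsub.congr (Filter.Eventually.of_forall fun p => ?_)
    simp only
    ring
  have hmean : ∫ p, (X₁ p.1 - X₂ p.2) ∂(μ₁.prod μ₂) = g₁ - g₂ := by
    rw [integral_sub (hi₁.comp_fst μ₂) (hi₂.comp_snd μ₁), integral_fun_fst, integral_fun_snd]
    simp [hg₁, hg₂]
  have key := integral_exp_truncate_le hW (by positivity) hsub' hmean hg hK hM s
  have hM0 : 0 ≤ M := by linarith [(abs_nonneg _).trans hg]
  have hmeas : Measurable fun p : Y × Y =>
      Real.exp (s * (g₁ - g₂ - truncate M (X₁ p.1 - X₂ p.2))) := by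
    have := measurable_truncate M
    fun_prop
  rw [lintegral_lintegral (f := fun y₁ y₂ => ENNReal.ofReal (Real.exp (s * (g₁ - g₂ -
        truncate M (X₁ y₁ - X₂ y₂))))) hmeas.ennreal_ofReal.aemeasurable]
  rw [← ofReal_integral_eq_lintegral_ofReal
    (Integrable.of_bound hmeas.aestronglyMeasurable (Real.exp (|s| * (|g₁ - g₂| + M)))
      (Filter.Eventually.of_forall fun p => ?_))
    (Filter.Eventually.of_forall fun _ => (Real.exp_pos _).le)]
  · refine ENNReal.ofReal_le_ofReal (key.trans (le_of_eq ?_))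
    push_cast
    ring_nf
  · rw [Real.norm_eq_abs, Real.abs_exp]
    refine Real.exp_le_exp.2 ((le_abs_self _).trans ?_)
    rw [abs_mul]
    have := (abs_sub (g₁ - g₂) (truncate M (X₁ p.1 - X₂ p.2))).trans
      (add_le_add le_rfl (abs_truncate_le hM0 _))
    gcongr

end Truncation

/-! ### Adaptive sampling: the law of the next output given the past. -/

section AdaptiveSampling

open scoped NNReal ENNReal

/-- Systems, permutations and indices chosen from the data take finitely many values, so
measurability can be checked for each fixed choice. -/
theorem Measurable.apply_of_countable {α β ι : Type*} [MeasurableSpace α] [MeasurableSpace β]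
    [MeasurableSpace ι] [Countable ι] [MeasurableSingletonClass ι] {p : α → ι} (hp : Measurable p)
    {J : ι → α → β} (hJ : ∀ i, Measurable (J i)) : Measurable fun a => J (p a) a :=
  (measurable_from_prod_countable_right (f := fun q : ι × α => J q.1 q.2) hJ).comp
    (hp.prodMk measurable_id)

variable {d N : ℕ}

namespace SimAlgorithm

/-- The outputs that are observed if the stopping rule is ignored. -/
def obs (A : SimAlgorithm d N) (out : ℕ → Grid d N → ℝ) (n : ℕ) : ℝ :=
  out n (A.sample n (A.history out n))

theorem history_eq (A : SimAlgorithm d N) (out : ℕ → Grid d N → ℝ) (n : ℕ) :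
    A.history out n = fun i : Fin n => A.obs out i := by
  induction n with
  | zero => funext i; exact i.elim0
  | succ n ih =>
    funext i
    refine Fin.lastCases ?_ (fun i => ?_) i
    · simp [history, obs]
    · simp [history, ih]

theorem history_congr (A : SimAlgorithm d N) {out out' : ℕ → Grid d N → ℝ} {n : ℕ}
    (h : ∀ m < n, out m = out' m) : A.history out n = A.history out' n := by
  induction n with
  | zero => rfl
  | succ n ih =>
    simp only [history]
    rw [ih fun m hm => h m (by omega), h n (by omega)]

variable {A : SimAlgorithm d N} (hA : A.IsMeasurable) (𝓜 : SimModel.{u} d N)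

include hA in
theorem measurable_history (n : ℕ) : Measurable fun ω => A.history (𝓜.output ω) n := by
  induction n with
  | zero => exact measurable_const
  | succ n ih =>
    refine measurable_pi_iff.2 fun i => ?_
    refine Fin.lastCases ?_ (fun i => ?_) i
    · simp only [history, Fin.snoc_last]
      exact Measurable.apply_of_countable (J := fun x ω => 𝓜.output ω n x) ((hA n).1.comp ih)
        fun x => (𝓜.measurable_F x).comp (measurable_pi_apply _)
    · simp only [history, Fin.snoc_castSucc]
      exact (measurable_pi_apply i).comp ih

include hA in
theorem measurable_obs : Measurable fun ω => A.obs (𝓜.output ω) := by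
  refine measurable_pi_iff.2 fun n => ?_
  exact Measurable.apply_of_countable (J := fun x ω => 𝓜.output ω n x)
    ((hA n).1.comp (measurable_history hA 𝓜 n))
    fun x => (𝓜.measurable_F x).comp (measurable_pi_apply _)

instance (𝓜 : SimModel.{u} d N) : IsProbabilityMeasure 𝓜.prob := by
  unfold SimModel.prob; infer_instance

include hA in
/-- The next random object is independent of the past. -/
theorem indepFun_history (n : ℕ) (x : Grid d N) :
    IndepFun (fun ω => A.history (𝓜.output ω) n) (fun ω => ω (n, x)) 𝓜.prob := by
  classical
  obtain ⟨y₀⟩ : Nonempty 𝓜.Y := nonempty_of_isProbabilityMeasure (𝓜.law x)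
  let S : Finset (ℕ × Grid d N) := Finset.range n ×ˢ Finset.univ
  have hi : iIndepFun (fun (p : ℕ × Grid d N) (ω : 𝓜.Sample) => ω p) 𝓜.prob :=
    iIndepFun_infinitePi (P := fun p : ℕ × Grid d N => 𝓜.law p.2) (X := fun _ y => y)
      fun _ => measurable_id
  have h := hi.indepFun_finset S {(n, x)} (by simp [S]) fun p => measurable_pi_apply p
  -- The first `n` outputs only read `ω` on the finite set `S`, so the default `y₀` outside is
  -- harmless and the history factors through the restriction to `S`.
  let ext : (S → 𝓜.Y) → 𝓜.Sample := fun r p => if hp : p ∈ S then r ⟨p, hp⟩ else y₀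
  have hext : Measurable ext := by
    refine measurable_pi_iff.2 fun p => ?_
    by_cases hp : p ∈ S
    · simpa [ext, hp] using measurable_pi_apply (⟨p, hp⟩ : S)
    · simp [ext, hp]
  have hψ : Measurable fun r : (({(n, x)} : Finset (ℕ × Grid d N)) → 𝓜.Y) =>
      r ⟨(n, x), by simp⟩ := measurable_pi_apply _
  have h' := h.comp ((measurable_history hA 𝓜 n).comp hext) hψ
  convert! h' using 1
  funext ω
  refine A.history_congr fun m hm => ?_
  funext y
  have : (m, y) ∈ S := by simp [S, hm]
  simp [SimModel.output, ext, this]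

include hA in
-- For a fixed system, independence makes the joint law of the past and the new random object a
-- product, and Tonelli applies.
theorem lintegral_history_apply (n : ℕ) (x : Grid d N) {H : (Fin n → ℝ) → 𝓜.Y → ℝ≥0∞}
    (hH : Measurable (Function.uncurry H)) :
    ∫⁻ ω, H (A.history (𝓜.output ω) n) (ω (n, x)) ∂𝓜.prob =
      ∫⁻ ω, ∫⁻ y, H (A.history (𝓜.output ω) n) y ∂(𝓜.law x) ∂𝓜.prob := by
  have hm := measurable_history hA 𝓜 n
  have hx : Measurable fun ω : 𝓜.Sample => ω (n, x) := measurable_pi_apply _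
  have h := (indepFun_iff_map_prod_eq_prod_map_map hm.aemeasurable hx.aemeasurable).1
    (indepFun_history hA 𝓜 n x)
  have hlaw : 𝓜.prob.map (fun ω : 𝓜.Sample => ω (n, x)) = 𝓜.law x :=
    Measure.infinitePi_map_eval (fun p : ℕ × Grid d N => 𝓜.law p.2) (n, x)
  rw [hlaw] at h
  have h1 := lintegral_map (μ := 𝓜.prob) hH (hm.prodMk hx)
  simp only [Function.uncurry] at h1
  rw [← h1, h, lintegral_prod (fun p => H p.1 p.2) hH.aemeasurable, lintegral_map _ hm]
  exact hH.lintegral_prod_right'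

include hA in
-- The next system is a function of the past with finitely many values. Splitting the integral by
-- that value reduces to a fixed system.
theorem lintegral_history_step (n : ℕ) {G : (Fin n → ℝ) → ℝ → ℝ≥0∞}
    (hG : Measurable (Function.uncurry G)) :
    ∫⁻ ω, G (A.history (𝓜.output ω) n) (A.obs (𝓜.output ω) n) ∂𝓜.prob =
      ∫⁻ ω, ∫⁻ y, G (A.history (𝓜.output ω) n)
        (𝓜.F (A.sample n (A.history (𝓜.output ω) n)) y)
          ∂(𝓜.law (A.sample n (A.history (𝓜.output ω) n))) ∂𝓜.prob := by
  classical
  let H : Grid d N → (Fin n → ℝ) → 𝓜.Y → ℝ≥0∞ := fun x h y =>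
    if A.sample n h = x then G h (𝓜.F x y) else 0
  have hH : ∀ x, Measurable (Function.uncurry (H x)) := by
    intro x
    have h1 : Measurable fun p : (Fin n → ℝ) × 𝓜.Y => G p.1 (𝓜.F x p.2) :=
      hG.comp (measurable_fst.prodMk ((𝓜.measurable_F x).comp measurable_snd))
    exact Measurable.ite (measurableSet_eq_fun ((hA n).1.comp measurable_fst) measurable_const)
      h1 measurable_const
  have e1 : ∀ ω : 𝓜.Sample, G (A.history (𝓜.output ω) n) (A.obs (𝓜.output ω) n) =
      ∑ x, H x (A.history (𝓜.output ω) n) (ω (n, x)) := by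
    intro ω
    rw [Finset.sum_ite_eq]
    simp [obs, SimModel.output]
  have e2 : ∀ ω : 𝓜.Sample, ∫⁻ y, G (A.history (𝓜.output ω) n)
      (𝓜.F (A.sample n (A.history (𝓜.output ω) n)) y)
        ∂(𝓜.law (A.sample n (A.history (𝓜.output ω) n))) =
      ∑ x, ∫⁻ y, H x (A.history (𝓜.output ω) n) y ∂(𝓜.law x) := by
    intro ω
    rw [Finset.sum_eq_single (A.sample n (A.history (𝓜.output ω) n))]
    · simp [H]
    · intro x _ hx
      simp [H, hx.symm]
    · simp
  have hm := measurable_history hA 𝓜 n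
  simp only [e1, e2]
  rw [lintegral_finsetSum, lintegral_finsetSum]
  · exact Finset.sum_congr rfl fun x _ => lintegral_history_apply hA 𝓜 n x (hH x)
  · exact fun x _ => (hH x).lintegral_prod_right'.comp hm
  · exact fun x _ => (hH x).comp (hm.prodMk (measurable_pi_apply _))

include hA in
/-- The conditional law of the next output given the past. -/
theorem lintegral_obs_step (n : ℕ) {G : (ℕ → ℝ) → ℝ → ℝ≥0∞}
    (hG : Measurable (Function.uncurry G))
    (hdep : ∀ z z' : ℕ → ℝ, (∀ j < n, z j = z' j) → G z = G z')
    {S : (ℕ → ℝ) → Grid d N}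
    (hS : ∀ ω, A.sample n (A.history (𝓜.output ω) n) = S (A.obs (𝓜.output ω))) :
    ∫⁻ ω, G (A.obs (𝓜.output ω)) (A.obs (𝓜.output ω) n) ∂𝓜.prob =
      ∫⁻ ω, ∫⁻ y, G (A.obs (𝓜.output ω)) (𝓜.F (S (A.obs (𝓜.output ω))) y)
        ∂(𝓜.law (S (A.obs (𝓜.output ω)))) ∂𝓜.prob := by
  -- By `hdep` only the first `n` outputs matter, so the full sequence may be replaced by its
  -- beginning continued by zeros.
  let pad : (Fin n → ℝ) → ℕ → ℝ := fun h j => if hj : j < n then h ⟨j, hj⟩ else 0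
  have hpad : Measurable pad := by
    refine measurable_pi_iff.2 fun j => ?_
    by_cases hj : j < n
    · simpa [pad, hj] using measurable_pi_apply (⟨j, hj⟩ : Fin n)
    · simp [pad, hj]
  have e : ∀ ω, G (A.obs (𝓜.output ω)) = G (pad (A.history (𝓜.output ω) n)) := by
    intro ω
    refine hdep _ _ fun j hj => ?_
    simp [pad, hj, history_eq]
  have key := lintegral_history_step hA 𝓜 n (G := fun h v => G (pad h) v)
    (hG.comp (hpad.prodMap measurable_id))
  simp only [← e, hS] at key
  exact key

end SimAlgorithm

end AdaptiveSampling

/-! ### Exponential supermartingales for predictable weights. -/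

section ExponentialSupermartingale

open scoped NNReal ENNReal

variable {d N : ℕ}

namespace SimAlgorithm

/-- The system of run `n`, as a function of the sequence of outputs. -/
def point (A : SimAlgorithm d N) (n : ℕ) (z : ℕ → ℝ) : Grid d N := A.sample n fun i => z i

theorem sample_history (A : SimAlgorithm d N) (out : ℕ → Grid d N → ℝ) (n : ℕ) :
    A.sample n (A.history out n) = A.point n (A.obs out) := by
  rw [history_eq, point]

theorem point_congr (A : SimAlgorithm d N) {n : ℕ} {z z' : ℕ → ℝ} (h : ∀ j < n, z j = z' j) :
    A.point n z = A.point n z' := by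
  unfold point
  congr 1
  funext i
  exact h i i.2

variable {A : SimAlgorithm d N} (hA : A.IsMeasurable) (𝓜 : SimModel.{u} d N)

include hA in
theorem measurable_point (n : ℕ) : Measurable (A.point n) :=
  (hA n).1.comp (measurable_pi_iff.2 fun _ => measurable_pi_apply _)

theorem measurable_objective_comp {α : Type*} [MeasurableSpace α] {p : α → Grid d N}
    (hp : Measurable p) : Measurable fun a => 𝓜.objective (p a) :=
  Measurable.apply_of_countable (J := fun x _ => 𝓜.objective x) hp fun _ => measurable_const

include hA in
/-- Sums of predictably weighted observation errors have sub-Gaussian exponential moments. -/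
theorem lintegral_exp_sum_le {c : ℝ≥0}
    (hsub : ∀ x, HasSubgaussianMGF (fun y => 𝓜.F x y - 𝓜.objective x) c (𝓜.law x))
    {w : ℕ → (ℕ → ℝ) → ℝ} (hw : ∀ m, Measurable (w m))
    (hwdep : ∀ m z z', (∀ j < m, z j = z' j) → w m z = w m z') (K : ℕ) :
    ∫⁻ ω, ENNReal.ofReal (Real.exp (∑ m ∈ Finset.range K,
      (w m (A.obs (𝓜.output ω)) * (A.obs (𝓜.output ω) m -
        𝓜.objective (A.point m (A.obs (𝓜.output ω)))) -
        c * w m (A.obs (𝓜.output ω)) ^ 2 / 2))) ∂𝓜.prob ≤ 1 := by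
  induction K with
  | zero => simp
  | succ K ih =>
    let V : ℕ → (ℕ → ℝ) → ℝ → ℝ := fun m z v =>
      w m z * (v - 𝓜.objective (A.point m z)) - c * w m z ^ 2 / 2
    have hV : ∀ m, Measurable (Function.uncurry (V m)) := by
      intro m
      have h1 : Measurable fun p : (ℕ → ℝ) × ℝ => w m p.1 := (hw m).comp measurable_fst
      have h2 : Measurable fun p : (ℕ → ℝ) × ℝ => 𝓜.objective (A.point m p.1) :=
        (measurable_objective_comp 𝓜 (measurable_point hA m)).comp measurable_fst
      exact (h1.mul (measurable_snd.sub h2)).sub (((h1.pow_const 2).const_mul _).div_const 2)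
    let Φ : (ℕ → ℝ) → ℝ := fun z => Real.exp (∑ m ∈ Finset.range K, V m z (z m))
    have hΦ : Measurable Φ := by
      refine Real.measurable_exp.comp (Finset.measurable_sum _ fun m _ => ?_)
      exact (hV m).comp (measurable_id.prodMk (measurable_pi_apply m))
    have hVdep : ∀ m z z', (∀ j < m, z j = z' j) → V m z = V m z' := by
      intro m z z' h
      simp only [V, hwdep m z z' h, A.point_congr h]
    have key := lintegral_obs_step hA 𝓜 K
      (G := fun z v => ENNReal.ofReal (Φ z * Real.exp (V K z v)))
      (((hΦ.comp measurable_fst).mul (Real.measurable_exp.comp (hV K))).ennreal_ofReal)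
      (fun z z' h => by
        funext v
        simp only [Φ, hVdep K z z' h]
        congr 3
        refine Finset.sum_congr rfl fun m hm => ?_
        rw [Finset.mem_range] at hm
        rw [hVdep m z z' fun j hj => h j (hj.trans hm), h m hm])
      (S := A.point K) (fun ω => A.sample_history _ _)
    calc _ = ∫⁻ ω, ENNReal.ofReal (Φ (A.obs (𝓜.output ω)) *
          Real.exp (V K (A.obs (𝓜.output ω)) (A.obs (𝓜.output ω) K))) ∂𝓜.prob := by
          refine lintegral_congr fun ω => ?_
          rw [Finset.sum_range_succ, Real.exp_add]
      _ ≤ ∫⁻ ω, ENNReal.ofReal (Φ (A.obs (𝓜.output ω))) ∂𝓜.prob := by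
          rw [key]
          refine lintegral_mono fun ω => ?_
          generalize A.obs (𝓜.output ω) = z
          have h1 : ∀ y, ENNReal.ofReal (Φ z * Real.exp (V K z (𝓜.F (A.point K z) y))) =
              ENNReal.ofReal (Φ z * Real.exp (-(c * w K z ^ 2 / 2))) *
              ENNReal.ofReal (Real.exp (w K z *
                (𝓜.F (A.point K z) y - 𝓜.objective (A.point K z)))) := by
            intro y
            have e : Real.exp (V K z (𝓜.F (A.point K z) y)) =
                Real.exp (-(c * w K z ^ 2 / 2)) * Real.exp (w K z *
                  (𝓜.F (A.point K z) y - 𝓜.objective (A.point K z))) := by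
              rw [← Real.exp_add]
              congr 1
              simp only [V]
              ring
            rw [← ENNReal.ofReal_mul (by positivity), mul_assoc, e]
          simp only [h1]
          rw [lintegral_const_mul' _ _ ENNReal.ofReal_ne_top,
            ← ofReal_integral_eq_lintegral_ofReal ((hsub _).integrable_exp_mul _)
              (Filter.Eventually.of_forall fun _ => (Real.exp_pos _).le),
            ← ENNReal.ofReal_mul (by positivity)]
          refine ENNReal.ofReal_le_ofReal ?_
          -- Given the past, the weight is a constant, and the compensator exactly cancels the bound
          -- on the moment generating function of the last error.
          have h2 := (hsub (A.point K z)).mgf_le (w K z)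
          unfold mgf at h2
          calc _ ≤ Φ z * Real.exp (-(c * w K z ^ 2 / 2)) * Real.exp (c * w K z ^ 2 / 2) :=
                mul_le_mul_of_nonneg_left h2 (by positivity)
            _ = Φ z := by rw [mul_assoc, ← Real.exp_add]; simp
      _ ≤ 1 := ih

include hA in
/-- Sums of predictably weighted errors of truncated differences of two consecutive outputs have
sub-Gaussian exponential moments, up to the truncation bias. -/
theorem lintegral_exp_sum_truncate_le {c : ℝ≥0} (hc : 0 < c)
    (hsub : ∀ x, HasSubgaussianMGF (fun y => 𝓜.F x y - 𝓜.objective x) c (𝓜.law x))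
    {w : ℕ → (ℕ → ℝ) → ℝ} (hw : ∀ m, Measurable (w m))
    (hwdep : ∀ m z z', (∀ j < 2 * m, z j = z' j) → w m z = w m z')
    {Q : ℕ → (ℕ → ℝ) → Grid d N} (hQ : ∀ m, Measurable (Q m))
    (hQdep : ∀ m z z', (∀ j < 2 * m, z j = z' j) → Q m z = Q m z') {k : ℕ}
    (hQs : ∀ m < k, ∀ z, A.point (2 * m + 1) z = Q m z)
    {M L K : ℝ} (hg : ∀ m < k, ∀ z,
      |𝓜.objective (A.point (2 * m) z) - 𝓜.objective (Q m z)| ≤ L)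
    (hK : 0 < K) (hM : L + K ≤ M) :
    ∫⁻ ω, ENNReal.ofReal (Real.exp (∑ m ∈ Finset.range k,
      (w m (A.obs (𝓜.output ω)) * (𝓜.objective (A.point (2 * m) (A.obs (𝓜.output ω))) -
        𝓜.objective (Q m (A.obs (𝓜.output ω))) -
        truncate M (A.obs (𝓜.output ω) (2 * m) - A.obs (𝓜.output ω) (2 * m + 1))) -
        (2 * c * w m (A.obs (𝓜.output ω)) ^ 2 + |w m (A.obs (𝓜.output ω))| *
          (4 * c / K * Real.exp (-K ^ 2 / (4 * c))))))) ∂𝓜.prob ≤ 1 := by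
  induction k with
  | zero => simp
  | succ k ih =>
    let g : ℕ → (ℕ → ℝ) → ℝ := fun m z =>
      𝓜.objective (A.point (2 * m) z) - 𝓜.objective (Q m z)
    let B : ℕ → (ℕ → ℝ) → ℝ := fun m z => 2 * c * w m z ^ 2 + |w m z| *
          (4 * c / K * Real.exp (-K ^ 2 / (4 * c)))
    have hgm : ∀ m, Measurable (g m) := fun m =>
      (measurable_objective_comp 𝓜 (measurable_point hA (2 * m))).sub
        (measurable_objective_comp 𝓜 (hQ m))
    have hBm : ∀ m, Measurable (B m) := by
      intro m
      have h1 := hw m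
      simp only [B]
      fun_prop
    have hgdep : ∀ m z z', (∀ j < 2 * m, z j = z' j) → g m z = g m z' := by
      intro m z z' h
      simp only [g, A.point_congr h, hQdep m z z' h]
    have hBdep : ∀ m z z', (∀ j < 2 * m, z j = z' j) → B m z = B m z' := by
      intro m z z' h
      simp only [B, hwdep m z z' h]
    let V : ℕ → (ℕ → ℝ) → ℝ := fun m z =>
      w m z * (g m z - truncate M (z (2 * m) - z (2 * m + 1))) - B m z
    have htr := measurable_truncate M
    have hVm : ∀ m, Measurable (V m) := by
      intro m
      have h1 := hw m
      have h2 := hgm m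
      have h3 := hBm m
      simp only [V]
      fun_prop
    have hVdep : ∀ m z z', (∀ j < 2 * m + 2, z j = z' j) → V m z = V m z' := by
      intro m z z' h
      have h' : ∀ j < 2 * m, z j = z' j := fun j hj => h j (by omega)
      simp only [V, hwdep m z z' h', hgdep m z z' h', hBdep m z z' h', h (2 * m) (by omega),
        h (2 * m + 1) (by omega)]
    let Φ : (ℕ → ℝ) → ℝ := fun z => Real.exp (∑ m ∈ Finset.range k, V m z)
    -- All that the past contributes at stage `k`: the earlier factors and the compensator of the
    -- new pair. It depends on the first `2k` outputs only.
    let Ψ : (ℕ → ℝ) → ℝ := fun z => Φ z * Real.exp (-B k z)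
    have hΦm : Measurable Φ :=
      Real.measurable_exp.comp (Finset.measurable_sum _ fun m _ => hVm m)
    have hΨm : Measurable Ψ := by
      have := hBm k
      simp only [Ψ]
      fun_prop
    have hΨdep : ∀ z z', (∀ j < 2 * k, z j = z' j) → Ψ z = Ψ z' := by
      intro z z' h
      simp only [Ψ, Φ, hBdep k z z' h]
      congr 2
      refine Finset.sum_congr rfl fun m hm => ?_
      rw [Finset.mem_range] at hm
      exact hVdep m z z' fun j hj => h j (by omega)
    let E : (ℕ → ℝ) → ℝ → ℝ → ℝ≥0∞ := fun z v₁ v₂ =>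
      ENNReal.ofReal (Real.exp (w k z * (g k z - truncate M (v₁ - v₂))))
    have hEdep : ∀ z z', (∀ j < 2 * k, z j = z' j) → E z = E z' := by
      intro z z' h
      simp only [E, hwdep k z z' h, hgdep k z z' h]
    have hEm : Measurable fun p : (ℕ → ℝ) × ℝ × ℝ => E p.1 p.2.1 p.2.2 := by
      have h1 := hw k
      have h2 := hgm k
      simp only [E]
      fun_prop
    -- The pair of outputs is integrated out from the last one backwards. The second system is
    -- written as `Q k`, which does not depend on output `2k`, so the result is an integral over two
    -- independent random objects at fixed systems.
    have key₁ := lintegral_obs_step hA 𝓜 (2 * k + 1)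
      (G := fun z v => ENNReal.ofReal (Ψ z) * E z (z (2 * k)) v)
      ((hΨm.comp measurable_fst).ennreal_ofReal.mul (hEm.comp (measurable_fst.prodMk
        (((measurable_pi_apply (2 * k)).comp measurable_fst).prodMk measurable_snd))))
      (fun z z' h => by
        have h' : ∀ j < 2 * k, z j = z' j := fun j hj => h j (by omega)
        simp only [hΨdep z z' h', hEdep z z' h', h (2 * k) (by omega)])
      (S := Q k) (fun ω => by rw [sample_history, hQs k (by omega)])
    have key₂ := lintegral_obs_step hA 𝓜 (2 * k)
      (G := fun z v => ENNReal.ofReal (Ψ z) *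
        ∫⁻ y₂, E z v (𝓜.F (Q k z) y₂) ∂(𝓜.law (Q k z)))
      (by
        refine (hΨm.comp measurable_fst).ennreal_ofReal.mul ?_
        refine Measurable.apply_of_countable (p := fun p : (ℕ → ℝ) × ℝ => Q k p.1)
          (J := fun x p => ∫⁻ y₂, E p.1 p.2 (𝓜.F x y₂) ∂(𝓜.law x))
          ((hQ k).comp measurable_fst) fun x => ?_
        refine Measurable.lintegral_prod_right'
          (f := fun q : ((ℕ → ℝ) × ℝ) × 𝓜.Y => E q.1.1 q.1.2 (𝓜.F x q.2)) ?_
        have := 𝓜.measurable_F x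
        exact hEm.comp (g := fun p : (ℕ → ℝ) × ℝ × ℝ => E p.1 p.2.1 p.2.2)
          (f := fun q : ((ℕ → ℝ) × ℝ) × 𝓜.Y => (q.1.1, q.1.2, 𝓜.F x q.2)) (by fun_prop))
      (fun z z' h => by simp only [hΨdep z z' h, hEdep z z' h, hQdep k z z' h])
      (S := A.point (2 * k)) (fun ω => A.sample_history _ _)
    calc _ = ∫⁻ ω, ENNReal.ofReal (Ψ (A.obs (𝓜.output ω))) * E (A.obs (𝓜.output ω))
            (A.obs (𝓜.output ω) (2 * k)) (A.obs (𝓜.output ω) (2 * k + 1)) ∂𝓜.prob := by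
          refine lintegral_congr fun ω => ?_
          generalize A.obs (𝓜.output ω) = z
          have e : Real.exp (V k z) = Real.exp (-B k z) *
              Real.exp (w k z * (g k z - truncate M (z (2 * k) - z (2 * k + 1)))) := by
            rw [← Real.exp_add]
            congr 1
            simp only [V]
            ring
          rw [Finset.sum_range_succ, Real.exp_add, ← ENNReal.ofReal_mul (by positivity)]
          change ENNReal.ofReal (Φ z * Real.exp (V k z)) = ENNReal.ofReal (Φ z * Real.exp (-B k z) *
            Real.exp (w k z * (g k z - truncate M (z (2 * k) - z (2 * k + 1)))))
          rw [e, mul_assoc]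
      _ = ∫⁻ ω, ENNReal.ofReal (Ψ (A.obs (𝓜.output ω))) *
            ∫⁻ y₁, ∫⁻ y₂, E (A.obs (𝓜.output ω))
              (𝓜.F (A.point (2 * k) (A.obs (𝓜.output ω))) y₁)
              (𝓜.F (Q k (A.obs (𝓜.output ω))) y₂) ∂(𝓜.law (Q k (A.obs (𝓜.output ω))))
              ∂(𝓜.law (A.point (2 * k) (A.obs (𝓜.output ω)))) ∂𝓜.prob := by
          rw [key₁]
          simp only [lintegral_const_mul' _ _ ENNReal.ofReal_ne_top] at key₂ ⊢
          exact key₂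
      _ ≤ ∫⁻ ω, ENNReal.ofReal (Φ (A.obs (𝓜.output ω))) ∂𝓜.prob := by
          refine lintegral_mono fun ω => ?_
          generalize A.obs (𝓜.output ω) = z
          have h1 := lintegral_exp_truncate_sub_le (𝓜.measurable_F (A.point (2 * k) z))
            (𝓜.measurable_F (Q k z)) hc (hsub _) (hsub _) (hg k (by omega) z) hK hM (w k z)
          calc _ ≤ ENNReal.ofReal (Ψ z) * ENNReal.ofReal (Real.exp (B k z)) :=
                mul_le_mul_right h1 _
            _ = ENNReal.ofReal (Φ z) := by
                rw [← ENNReal.ofReal_mul (by positivity)]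
                simp only [Ψ]
                rw [mul_assoc, ← Real.exp_add]
                simp
      _ ≤ 1 := ih (fun m hm => hQs m (by omega)) (fun m hm => hg m (by omega))

end SimAlgorithm

end ExponentialSupermartingale

/-! ### The algorithm as a map of its outputs: measurability, locality and the systems it simulates.
-/

section SSGDStructure

open scoped NNReal ENNReal

variable {d N : ℕ}

theorem measurable_cubeCorner (N : ℕ) : Measurable (cubeCorner N) := by
  unfold cubeCorner
  exact measurable_const.max (Int.measurable_floor.min measurable_const)

/-- Each level set of the sorting permutation is cut out by finitely many comparisons of fractional
parts, with ties broken by the index. -/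
theorem measurable_comp_consistentPerm {α β : Type*} [MeasurableSpace α] [MeasurableSpace β]
    (N : ℕ) {x : α → Fin d → ℝ} (hx : Measurable x) {J : Equiv.Perm (Fin d) → α → β}
    (hJ : ∀ π, Measurable (J π)) : Measurable fun a => J (consistentPerm N (x a)) a := by
  let _ : MeasurableSpace (Equiv.Perm (Fin d)) := ⊤
  refine Measurable.apply_of_countable (p := fun a => consistentPerm N (x a))
    (Measurable.comp (g := consistentPerm N) ?_ hx) hJ
  refine measurable_to_countable' fun π => ?_
  have hfrac : ∀ k : Fin d, Measurable fun x : Fin d → ℝ => -(x k - (cubeCorner N (x k) : ℝ)) := by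
    intro k
    have h2 : Measurable fun x : Fin d → ℝ => ((cubeCorner N (x k) : ℤ) : ℝ) :=
      (measurable_from_top (f := fun n : ℤ => (n : ℝ))).comp
        ((measurable_cubeCorner N).comp (measurable_pi_apply k))
    exact ((measurable_pi_apply k).sub h2).neg
  have e : consistentPerm N ⁻¹' {π} = {x : Fin d → ℝ |
      (∀ i j : Fin d, i ≤ j → -(x (π i) - (cubeCorner N (x (π i)) : ℝ)) ≤
        -(x (π j) - (cubeCorner N (x (π j)) : ℝ)))} ∩ {x : Fin d → ℝ |
      ∀ i j : Fin d, i < j → -(x (π i) - (cubeCorner N (x (π i)) : ℝ)) =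
        -(x (π j) - (cubeCorner N (x (π j)) : ℝ)) → π i < π j} := by
    ext x
    rw [Set.mem_preimage, Set.mem_singleton_iff, eq_comm, consistentPerm, Tuple.eq_sort_iff]
    rfl
  rw [e]
  refine MeasurableSet.inter (measurableSet_setOfPred.2 ?_) (measurableSet_setOfPred.2 ?_)
  · exact Measurable.forall fun i => Measurable.forall fun j => measurable_const.imp
      (measurableSet_setOfPred.1 (measurableSet_le (hfrac _) (hfrac _)))
  · exact Measurable.forall fun i => Measurable.forall fun j => measurable_const.imp
      ((measurableSet_setOfPred.1 (measurableSet_eq_fun (hfrac _) (hfrac _))).imp measurable_const)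

theorem measurable_neighbor (hN : 2 ≤ N) {α : Type*} [MeasurableSpace α] {x : α → Fin d → ℝ}
    (hx : Measurable x) (i : ℕ) : Measurable fun a => neighbor hN (x a) i := by
  refine measurable_pi_iff.2 fun k => Measurable.subtype_mk ?_
  refine measurable_comp_consistentPerm N hx
    (J := fun π a => cubeCorner N (x a k) + if (π.symm k : ℕ) < i then 1 else 0) fun π => ?_
  exact ((measurable_cubeCorner N).comp ((measurable_pi_apply k).comp hx)).add measurable_const

theorem measurable_ssgdIterate (d N : ℕ) (M η : ℝ) (t : ℕ) :
    Measurable fun z => ssgdIterate d N M η z t := by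
  induction t with
  | zero => exact measurable_const
  | succ t ih =>
    refine measurable_pi_iff.2 fun k => ?_
    have h1 : Measurable fun z : ℕ → ℝ => ssgdIterate d N M η z t k :=
      (measurable_pi_apply k).comp ih
    have h2 : Measurable fun z : ℕ → ℝ => stochSubgrad N z t (ssgdIterate d N M η z t) k := by
      refine measurable_comp_consistentPerm N ih (J := fun π z =>
        z (2 * d * t + 2 * (π.symm k : ℕ)) - z (2 * d * t + 2 * (π.symm k : ℕ) + 1)) fun π => ?_
      fun_prop
    simp only [ssgdIterate]
    fun_prop

theorem measurable_ssgdAverage (d N T : ℕ) (M η : ℝ) :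
    Measurable fun z => ssgdAverage d N T M η z := by
  refine measurable_pi_iff.2 fun k => ?_
  exact (Finset.measurable_sum _ fun t _ =>
    (measurable_pi_apply k).comp (measurable_ssgdIterate d N M η t)).div_const _

theorem ssgdIterate_congr (d N : ℕ) (M η : ℝ) (t : ℕ) {z z' : ℕ → ℝ}
    (h : ∀ j < 2 * d * t, z j = z' j) : ssgdIterate d N M η z t = ssgdIterate d N M η z' t := by
  induction t with
  | zero => rfl
  | succ t ih =>
    have e : 2 * d * (t + 1) = 2 * d * t + 2 * d := by ring
    rw [e] at h
    funext k
    simp only [ssgdIterate, stochSubgrad]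
    rw [ih fun j hj => h j (by omega)]
    have := ((consistentPerm N (ssgdIterate d N M η z' t)).symm k).2
    rw [h _ (by omega), h _ (by omega)]

theorem ssgdAverage_congr (d N T : ℕ) (M η : ℝ) {z z' : ℕ → ℝ}
    (h : ∀ j < 2 * d * T, z j = z' j) : ssgdAverage d N T M η z = ssgdAverage d N T M η z' := by
  funext k
  simp only [ssgdAverage]
  congr 1
  refine Finset.sum_congr rfl fun t ht => ?_
  rw [ssgdIterate_congr d N M η t fun j hj => h j (hj.trans_le ?_)]
  exact Nat.mul_le_mul_left _ (Finset.mem_range.1 ht).le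

theorem ssgdIterate_mem (hN : 2 ≤ N) (M η : ℝ) (z : ℕ → ℝ) (t : ℕ) (k : Fin d) :
    ssgdIterate d N M η z t k ∈ Set.Icc (1 : ℝ) N := by
  have hN' : (2 : ℝ) ≤ N := by exact_mod_cast hN
  cases t with
  | zero => simp only [ssgdIterate]; constructor <;> linarith
  | succ t =>
    simp only [ssgdIterate]
    exact ⟨le_max_right _ _, max_le (min_le_right _ _) (by linarith)⟩

theorem ssgdAverage_mem (hN : 2 ≤ N) {T : ℕ} (hT : 0 < T) (M η : ℝ) (z : ℕ → ℝ) (k : Fin d) :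
    ssgdAverage d N T M η z k ∈ Set.Icc (1 : ℝ) N := by
  have hT' : (0 : ℝ) < T := by exact_mod_cast hT
  simp only [ssgdAverage, Set.mem_Icc]
  rw [le_div_iff₀ hT', div_le_iff₀ hT']
  constructor
  · have := Finset.card_nsmul_le_sum (Finset.range T) (fun t => ssgdIterate d N M η z t k) 1
      fun t _ => (ssgdIterate_mem hN M η z t k).1
    simpa using this
  · have := Finset.sum_le_card_nsmul (Finset.range T) (fun t => ssgdIterate d N M η z t k) N
      fun t _ => (ssgdIterate_mem hN M η z t k).2
    simpa [mul_comm] using this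

/-- Continuing a history by zeros is measurable. -/
theorem measurable_padding (m : ℕ) :
    Measurable fun (h : Fin m → ℝ) (j : ℕ) => if hj : j < m then h ⟨j, hj⟩ else 0 := by
  refine measurable_pi_iff.2 fun j => ?_
  by_cases hj : j < m
  · simpa [hj] using measurable_pi_apply (⟨j, hj⟩ : Fin m)
  · simp [hj]

theorem argminIndex_le {m : ℕ} (v : Fin (m + 1) → ℝ) (j : Fin (m + 1)) :
    v (argminIndex v) ≤ v j := by
  have := Finset.min'_mem (Finset.univ.filter fun i => ∀ j, v i ≤ v j) (by
    obtain ⟨i, hi⟩ := Finite.exists_min v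
    exact ⟨i, by simpa using hi⟩)
  exact (Finset.mem_filter.1 this).2 j

theorem argminIndex_eq_iff {m : ℕ} (v : Fin (m + 1) → ℝ) (i : Fin (m + 1)) :
    argminIndex v = i ↔ (∀ j, v i ≤ v j) ∧ ∀ i', (∀ j, v i' ≤ v j) → i ≤ i' := by
  constructor
  · rintro rfl
    exact ⟨argminIndex_le v, fun i' hi' => Finset.min'_le _ _ (by simpa using hi')⟩
  · rintro ⟨h1, h2⟩
    exact le_antisymm (Finset.min'_le _ _ (by simpa using h1)) (h2 _ (argminIndex_le v))

theorem measurable_argminIndex (m : ℕ) : Measurable (argminIndex (m := m)) := by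
  refine measurable_to_countable' fun i => ?_
  have e : argminIndex ⁻¹' {i} = {v : Fin (m + 1) → ℝ | ∀ j, v i ≤ v j} ∩
      {v : Fin (m + 1) → ℝ | ∀ i', (∀ j, v i' ≤ v j) → i ≤ i'} := by
    ext v
    exact argminIndex_eq_iff v i
  rw [e]
  have hle : ∀ i j : Fin (m + 1), Measurable fun v : Fin (m + 1) → ℝ => v i ≤ v j := fun i j =>
    measurableSet_setOfPred.1 (measurableSet_le (measurable_pi_apply i) (measurable_pi_apply j))
  exact (measurableSet_setOfPred.2 (Measurable.forall fun j => hle i j)).inter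
    (measurableSet_setOfPred.2 (Measurable.forall fun i' =>
      (Measurable.forall fun j => hle i' j).imp measurable_const))

theorem ssgd_isMeasurable (hN : 2 ≤ N) (σ ε δ : ℝ) (T : ℕ) (M η : ℝ) :
    (ssgd (d := d) hN σ ε δ T M η).IsMeasurable := by
  intro m
  refine ⟨?_, ?_, ?_⟩
  · simp only [ssgd]
    split_ifs
    · exact measurable_neighbor hN
        ((measurable_ssgdIterate d N M η _).comp (measurable_padding m)) _
    · exact measurable_neighbor hN
        ((measurable_ssgdIterate d N M η _).comp (measurable_padding m)) _
    · exact measurable_neighbor hN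
        ((measurable_ssgdAverage d N T M η).comp (measurable_padding m)) _
  · simp only [ssgd]
    exact MeasurableSet.const _
  · simp only [ssgd]
    have hx := (measurable_ssgdAverage d N T M η).comp (measurable_padding m)
    refine Measurable.apply_of_countable (J := fun (i : Fin (d + 1)) (h : Fin m → ℝ) =>
      neighbor hN (ssgdAverage d N T M η fun j => if hj : j < m then h ⟨j, hj⟩ else 0) i)
      ((measurable_argminIndex d).comp (measurable_pi_iff.2 fun i => ?_))
      fun i => measurable_neighbor hN hx i
    exact (Finset.measurable_sum (Finset.range (roundingSize σ ε δ)) fun j _ =>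
      (measurable_pi_apply (2 * d * T + i * roundingSize σ ε δ + j)).comp
        (measurable_padding m)).div_const _

/-- The total number of simulations of the algorithm. -/
noncomputable def ssgdCost (d T : ℕ) (σ ε δ : ℝ) : ℕ := 2 * d * T + (d + 1) * roundingSize σ ε δ

/-- The stopping rule ignores the outputs, so the cost is deterministic; almost sure and expected
bounds coincide. -/
theorem ssgd_stopTime (hN : 2 ≤ N) (σ ε δ : ℝ) (T : ℕ) (M η : ℝ) (out : ℕ → Grid d N → ℝ) :
    (ssgd (d := d) hN σ ε δ T M η).stopTime out = ssgdCost d T σ ε δ := by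
  unfold SimAlgorithm.stopTime
  refine le_antisymm (iInf₂_le _ ?_) (le_iInf₂ fun n hn => ?_)
  · exact le_refl (2 * d * T + (d + 1) * roundingSize σ ε δ)
  · exact Nat.cast_le.2 (show ssgdCost d T σ ε δ ≤ n from hn)

/-- The simulations of the descent phase come in `d T` pairs. Pair `m` belongs to iteration `m / d`
and chain step `m % d`, and that iterate only depends on outputs before the pair. -/
theorem ssgd_point_even (hN : 2 ≤ N) (σ ε δ : ℝ) {T : ℕ} (M η : ℝ) {m : ℕ}
    (hm : m < d * T) (z : ℕ → ℝ) :
    (ssgd hN σ ε δ T M η).point (2 * m) z =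
      neighbor hN (ssgdIterate d N M η z (m / d)) (m % d + 1) := by
  have h1 : 2 * m < 2 * d * T := by rw [mul_assoc]; omega
  have h2 : 2 * m / (2 * d) = m / d := Nat.mul_div_mul_left _ _ two_pos
  have h3 : 2 * m % (2 * d) / 2 = m % d := by rw [Nat.mul_mod_mul_left]; omega
  simp only [SimAlgorithm.point, ssgd, h1, h2, h3, Nat.mul_mod_right, if_true]
  rw [ssgdIterate_congr d N M η (m / d)]
  intro j hj
  have : d * (m / d) ≤ m := Nat.mul_div_le m d
  rw [mul_assoc] at hj
  simp [show j < 2 * m by omega]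

theorem ssgd_point_odd (hN : 2 ≤ N) (σ ε δ : ℝ) {T : ℕ} (M η : ℝ) {m : ℕ}
    (hm : m < d * T) (z : ℕ → ℝ) :
    (ssgd hN σ ε δ T M η).point (2 * m + 1) z =
      neighbor hN (ssgdIterate d N M η z (m / d)) (m % d) := by
  have h1 : 2 * m + 1 < 2 * d * T := by rw [mul_assoc]; omega
  have h2 : (2 * m + 1) / (2 * d) = m / d := by
    rw [← Nat.div_div_eq_div_mul]; congr 1; omega
  have h3 : (2 * m + 1) % (2 * d) / 2 = m % d := by
    rw [Nat.mod_mul_right_div_self]; congr 1; omega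
  have h4 : ¬ (2 * m + 1) % 2 = 0 := by omega
  simp only [SimAlgorithm.point, ssgd, h1, h2, h3, h4, if_true, if_false]
  rw [ssgdIterate_congr d N M η (m / d)]
  intro j hj
  have : d * (m / d) ≤ m := Nat.mul_div_le m d
  rw [mul_assoc] at hj
  simp [show j < 2 * m + 1 by omega]

theorem ssgd_point_rounding (hN : 2 ≤ N) (σ ε δ : ℝ) (T : ℕ) (M η : ℝ) {i j : ℕ}
    (hj : j < roundingSize σ ε δ) (z : ℕ → ℝ) :
    (ssgd (d := d) hN σ ε δ T M η).point (2 * d * T + i * roundingSize σ ε δ + j) z =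
      neighbor hN (ssgdAverage d N T M η z) i := by
  have h1 : ¬ 2 * d * T + i * roundingSize σ ε δ + j < 2 * d * T := by omega
  have h2 : (2 * d * T + i * roundingSize σ ε δ + j - 2 * d * T) / roundingSize σ ε δ = i := by
    rw [add_assoc, Nat.add_sub_cancel_left, mul_comm, Nat.mul_add_div (by omega),
      Nat.div_eq_of_lt hj, add_zero]
  simp only [SimAlgorithm.point, ssgd, h1, h2, if_false]
  rw [ssgdAverage_congr d N T M η]
  intro k hk
  simp [show k < 2 * d * T + i * roundingSize σ ε δ + j by omega]

/-- The empirical mean of neighbouring point `i` in the rounding step. -/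
noncomputable def roundingMean (d T : ℕ) (σ ε δ : ℝ) (z : ℕ → ℝ) (i : ℕ) : ℝ :=
  (∑ j ∈ Finset.range (roundingSize σ ε δ), z (2 * d * T + i * roundingSize σ ε δ + j)) /
    roundingSize σ ε δ

theorem ssgd_result (hN : 2 ≤ N) (σ ε δ : ℝ) (T : ℕ) (M η : ℝ) (out : ℕ → Grid d N → ℝ) :
    (ssgd (d := d) hN σ ε δ T M η).result out =
      neighbor hN (ssgdAverage d N T M η ((ssgd (d := d) hN σ ε δ T M η).obs out))
        (argminIndex (m := d) fun i =>
          roundingMean d T σ ε δ ((ssgd (d := d) hN σ ε δ T M η).obs out) i) := by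
  have e : ((ssgd (d := d) hN σ ε δ T M η).stopTime out).toNat = ssgdCost d T σ ε δ := by
    rw [ssgd_stopTime]; rfl
  rw [SimAlgorithm.result, e, SimAlgorithm.history_eq]
  generalize (ssgd (d := d) hN σ ε δ T M η).obs out = z
  simp only [ssgd]
  have hle : 2 * d * T ≤ ssgdCost d T σ ε δ := by unfold ssgdCost; omega
  rw [ssgdAverage_congr d N T M η (z' := z) fun j hj => by simp [show j < ssgdCost d T σ ε δ by omega]]
  congr 3
  funext i
  unfold roundingMean
  congr 1
  refine Finset.sum_congr rfl fun j hj => ?_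
  rw [dif_pos]
  rw [Finset.mem_range] at hj
  have h1 : ((i : ℕ) + 1) * roundingSize σ ε δ ≤ (d + 1) * roundingSize σ ε δ :=
    Nat.mul_le_mul_right _ (by omega)
  rw [add_mul, one_mul] at h1
  unfold ssgdCost
  omega

end SSGDStructure

/-! ### Regret of the truncated descent. -/

section Regret

variable {d N : ℕ}

/-- The projection is nonexpansive and fixes `v`. -/
theorem sq_project_sub_le {N a v : ℝ} (hv : v ∈ Set.Icc 1 N) :
    (max (min a N) 1 - v) ^ 2 ≤ (a - v) ^ 2 := by
  rw [sq_le_sq]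
  have e : max (min v N) 1 = v := by rw [min_eq_left hv.2, max_eq_left hv.1]
  calc |max (min a N) 1 - v| = |max (min a N) 1 - max (min v N) 1| := by rw [e]
    _ ≤ |min a N - min v N| := abs_max_sub_max_le_abs _ _ _
    _ ≤ |a - v| := (abs_min_sub_min_le_max a N v N).trans (by simp)

/-- The regret of one coordinate of the truncated subgradient descent. -/
theorem ssgd_coordinate_regret (hN : 2 ≤ N) {M η : ℝ} (hM : 0 ≤ M) (z : ℕ → ℝ)
    (k : Fin d) {v : ℝ} (hv : v ∈ Set.Icc (1 : ℝ) N) (T : ℕ) :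
    2 * η * ∑ t ∈ Finset.range T, (ssgdIterate d N M η z t k - v) *
      truncate M (stochSubgrad N z t (ssgdIterate d N M η z t) k) ≤
      N ^ 2 + T * (η ^ 2 * M ^ 2) - (ssgdIterate d N M η z T k - v) ^ 2 := by
  induction T with
  | zero =>
    have hN' : (2 : ℝ) ≤ N := by exact_mod_cast hN
    simp only [ssgdIterate, Finset.range_zero, Finset.sum_empty, mul_zero, Nat.cast_zero, zero_mul,
      add_zero]
    have h1 := hv.1
    have h2 := hv.2
    nlinarith
  | succ T ih =>
    rw [Finset.sum_range_succ, mul_add]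
    -- Expanding the square of the unprojected step trades the inner product with the gradient for a
    -- decrease of the squared distance to `v`, up to `η² M²`.
    have hproj := sq_project_sub_le (a := ssgdIterate d N M η z T k - η *
      truncate M (stochSubgrad N z T (ssgdIterate d N M η z T) k)) hv
    have e : max (min (ssgdIterate d N M η z T k - η *
      truncate M (stochSubgrad N z T (ssgdIterate d N M η z T) k)) N) 1 =
      ssgdIterate d N M η z (T + 1) k := rfl
    rw [e] at hproj
    have htr : truncate M (stochSubgrad N z T (ssgdIterate d N M η z T) k) ^ 2 ≤ M ^ 2 :=
      sq_le_sq' (abs_le.1 (abs_truncate_le hM _)).1 (abs_le.1 (abs_truncate_le hM _)).2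
    have htr' := mul_le_mul_of_nonneg_left htr (sq_nonneg η)
    push_cast
    linarith

/-- The deviation from `v` of the coordinate of the iterate that is updated with the outputs
`2 m` and `2 m + 1`. -/
noncomputable def ssgdWeight (hd : 0 < d) (N : ℕ) (M η : ℝ) (v : Fin d → ℝ) (m : ℕ)
    (z : ℕ → ℝ) : ℝ :=
  ssgdIterate d N M η z (m / d)
      (consistentPerm N (ssgdIterate d N M η z (m / d)) ⟨m % d, Nat.mod_lt _ hd⟩) -
    v (consistentPerm N (ssgdIterate d N M η z (m / d)) ⟨m % d, Nat.mod_lt _ hd⟩)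

theorem ssgdWeight_congr (hd : 0 < d) (N : ℕ) (M η : ℝ) (v : Fin d → ℝ) (m : ℕ) {z z' : ℕ → ℝ}
    (h : ∀ j < 2 * m, z j = z' j) :
    ssgdWeight hd N M η v m z = ssgdWeight hd N M η v m z' := by
  have : d * (m / d) ≤ m := Nat.mul_div_le m d
  rw [ssgdWeight, ssgdWeight, ssgdIterate_congr d N M η (m / d) fun j hj => h j (by
    rw [mul_assoc] at hj; omega)]

theorem measurable_ssgdWeight (hd : 0 < d) (N : ℕ) (M η : ℝ) (v : Fin d → ℝ) (m : ℕ) :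
    Measurable (ssgdWeight hd N M η v m) := by
  have h := measurable_ssgdIterate d N M η (m / d)
  refine measurable_comp_consistentPerm N h (J := fun π z =>
    ssgdIterate d N M η z (m / d) (π ⟨m % d, Nat.mod_lt _ hd⟩) - v (π ⟨m % d, Nat.mod_lt _ hd⟩))
    fun π => ?_
  exact ((measurable_pi_apply _).comp h).sub_const _

theorem abs_ssgdWeight_le (hd : 0 < d) (hN : 2 ≤ N) (M η : ℝ) {v : Fin d → ℝ}
    (hv : ∀ k, v k ∈ Set.Icc (1 : ℝ) N) (m : ℕ) (z : ℕ → ℝ) :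
    |ssgdWeight hd N M η v m z| ≤ N := by
  unfold ssgdWeight
  generalize (consistentPerm N (ssgdIterate d N M η z (m / d))) ⟨m % d, Nat.mod_lt _ hd⟩ = k
  have h1 := ssgdIterate_mem hN M η z (m / d) k
  have h2 := hv k
  rw [abs_le]
  constructor <;> linarith [h1.1, h1.2, h2.1, h2.2]

/-- Reindexing between the time order of the pairs and the coordinates: in each iteration, the
consistent permutation maps chain steps to coordinates. -/
theorem sum_ssgdWeight (hd : 0 < d) (hN : 2 ≤ N) (f : Grid d N → ℝ) (M η : ℝ) (v : Fin d → ℝ)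
    (z : ℕ → ℝ) (T : ℕ) :
    ∑ m ∈ Finset.range (d * T), ssgdWeight hd N M η v m z *
      (f (neighbor hN (ssgdIterate d N M η z (m / d)) (m % d + 1)) -
        f (neighbor hN (ssgdIterate d N M η z (m / d)) (m % d)) -
        truncate M (z (2 * m) - z (2 * m + 1))) =
    ∑ t ∈ Finset.range T, ∑ k, (ssgdIterate d N M η z t k - v k) *
      (lovaszGrad hN f (ssgdIterate d N M η z t) k -
        truncate M (stochSubgrad N z t (ssgdIterate d N M η z t) k)) := by
  induction T with
  | zero => simp
  | succ T ih =>
    rw [mul_add, mul_one, Finset.sum_range_add, ih, Finset.sum_range_succ]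
    congr 1
    rw [← Fin.sum_univ_eq_sum_range (fun i => ssgdWeight hd N M η v (d * T + i) z *
      (f (neighbor hN (ssgdIterate d N M η z ((d * T + i) / d)) ((d * T + i) % d + 1)) -
        f (neighbor hN (ssgdIterate d N M η z ((d * T + i) / d)) ((d * T + i) % d)) -
        truncate M (z (2 * (d * T + i)) - z (2 * (d * T + i) + 1))))]
    refine Eq.trans ?_ (Equiv.sum_comp (consistentPerm N (ssgdIterate d N M η z T)) _)
    refine Finset.sum_congr rfl fun i _ => ?_
    have h1 : (d * T + (i : ℕ)) / d = T := by
      rw [Nat.mul_add_div hd, Nat.div_eq_of_lt i.2, add_zero]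
    have h2 : (d * T + (i : ℕ)) % d = i := by
      rw [Nat.mul_add_mod, Nat.mod_eq_of_lt i.2]
    have h3 : 2 * (d * T + (i : ℕ)) = 2 * d * T + 2 * i := by ring
    simp only [ssgdWeight, h1, h2, h3, lovaszGrad, stochSubgrad, Equiv.symm_apply_apply]

/-- The error of the averaging point, in terms of the subgradient noise. -/
theorem ssgdAverage_error_le (hd : 0 < d) (hN : 2 ≤ N) {f : Grid d N → ℝ}
    (hf : LNaturalConvex f) {M : ℝ} (hM : 0 < M) {T : ℕ} (hT : 0 < T) (q : Grid d N)
    (z : ℕ → ℝ) {η : ℝ} (hη : η = N / (M * √T)) :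
    T * (lovaszExt hN f (ssgdAverage d N T M η z) - f q) ≤
      d * N * M * √T + ∑ m ∈ Finset.range (d * T),
        ssgdWeight hd N M η (fun k => ((q k : ℤ) : ℝ)) m z *
          (f (neighbor hN (ssgdIterate d N M η z (m / d)) (m % d + 1)) -
            f (neighbor hN (ssgdIterate d N M η z (m / d)) (m % d)) -
            truncate M (z (2 * m) - z (2 * m + 1))) := by
  have hT' : (0 : ℝ) < T := by exact_mod_cast hT
  have hsT : 0 < √(T : ℝ) := Real.sqrt_pos.2 hT'
  have hN0 : (0 : ℝ) < N := by
    have : (2 : ℝ) ≤ N := by exact_mod_cast hN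
    linarith
  have hη0 : 0 < η := by rw [hη]; positivity
  set x := fun t => ssgdIterate d N M η z t with hx
  set a := ssgdAverage d N T M η z with ha
  have hq : ∀ k, ((q k : ℤ) : ℝ) ∈ Set.Icc (1 : ℝ) N := fun k => by
    have := (q k).2
    exact ⟨by exact_mod_cast this.1, by exact_mod_cast this.2⟩
  -- Jensen's inequality for the average is obtained from the subgradient at the average itself,
  -- whose linear terms cancel.
  have havg : ∑ t ∈ Finset.range T, ∑ k, lovaszGrad hN f a k * (x t k - a k) = 0 := by
    rw [Finset.sum_comm]
    refine Finset.sum_eq_zero fun k _ => ?_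
    rw [← Finset.mul_sum, Finset.sum_sub_distrib]
    have : a k = (∑ t ∈ Finset.range T, x t k) / T := rfl
    simp only [Finset.sum_const, Finset.card_range, nsmul_eq_mul]
    rw [this]
    field_simp
    ring
  have h1 : T * lovaszExt hN f a ≤ ∑ t ∈ Finset.range T, lovaszExt hN f (x t) := by
    have := Finset.sum_le_sum fun t (_ : t ∈ Finset.range T) =>
      lovaszExt_add_le hN hf a (fun k => ssgdIterate_mem hN M η z t k)
    rw [Finset.sum_add_distrib, havg] at this
    simpa using this
  have h2 : ∑ t ∈ Finset.range T, lovaszExt hN f (x t) ≤ T * f q +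
      ∑ t ∈ Finset.range T, ∑ k, (x t k - ((q k : ℤ) : ℝ)) * lovaszGrad hN f (x t) k := by
    have := Finset.sum_le_sum fun t (_ : t ∈ Finset.range T) =>
      lovaszExt_add_le_apply hN hf (x t) q
    rw [Finset.sum_add_distrib] at this
    simp only [Finset.sum_const, Finset.card_range, nsmul_eq_mul] at this
    have e : ∑ t ∈ Finset.range T, ∑ k, lovaszGrad hN f (x t) k * (((q k : ℤ) : ℝ) - x t k) =
        -∑ t ∈ Finset.range T, ∑ k, (x t k - ((q k : ℤ) : ℝ)) * lovaszGrad hN f (x t) k := by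
      simp only [← Finset.sum_neg_distrib]
      refine Finset.sum_congr rfl fun t _ => Finset.sum_congr rfl fun k _ => ?_
      ring
    linarith
  have h3 : ∑ t ∈ Finset.range T, ∑ k, (x t k - ((q k : ℤ) : ℝ)) *
      truncate M (stochSubgrad N z t (x t) k) ≤ d * N * M * √T := by
    rw [Finset.sum_comm]
    have hk : ∀ k : Fin d, ∑ t ∈ Finset.range T, (x t k - ((q k : ℤ) : ℝ)) *
        truncate M (stochSubgrad N z t (x t) k) ≤ N * M * √T := by
      intro k
      have h := ssgd_coordinate_regret hN hM.le z k (hq k) (η := η) T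
      -- The step size balances the two contributions: both equal `N²`.
      have e : (N : ℝ) ^ 2 + T * (η ^ 2 * M ^ 2) = 2 * η * (N * M * √T) := by
        rw [hη]
        field_simp
        rw [Real.sq_sqrt hT'.le]
        ring
      rw [e] at h
      have h' := h.trans (sub_le_self _ (sq_nonneg _))
      exact le_of_mul_le_mul_left h' (by positivity)
    refine (Finset.sum_le_sum fun k _ => hk k).trans (le_of_eq ?_)
    simp
    ring
  rw [sum_ssgdWeight]
  simp only [mul_sub, Finset.sum_sub_distrib] at h3 ⊢
  linarith

end Regret

/-! ### Tail bounds for descent and rounding, and the PGS guarantee. -/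

section Guarantee

open scoped NNReal ENNReal

theorem measure_ge_le_exp_neg {Ω : Type*} [MeasurableSpace Ω] {μ : Measure Ω} {X : Ω → ℝ}
    (hX : Measurable X) (h : ∫⁻ ω, ENNReal.ofReal (Real.exp (X ω)) ∂μ ≤ 1) (a : ℝ) :
    μ {ω | a ≤ X ω} ≤ ENNReal.ofReal (Real.exp (-a)) := by
  have h1 := meas_ge_le_lintegral_div (μ := μ) (Real.measurable_exp.comp hX).ennreal_ofReal.aemeasurable
    (ε := ENNReal.ofReal (Real.exp a)) (by simpa using Real.exp_pos a) ENNReal.ofReal_ne_top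
  have h2 : {ω | a ≤ X ω} ⊆
      {ω | ENNReal.ofReal (Real.exp a) ≤ ENNReal.ofReal ((Real.exp ∘ X) ω)} := fun ω hω =>
    ENNReal.ofReal_le_ofReal (Real.exp_le_exp.2 hω)
  refine (measure_mono h2).trans (h1.trans ?_)
  rw [Real.exp_neg, ENNReal.ofReal_inv_of_pos (Real.exp_pos a), ← one_div]
  exact ENNReal.div_le_div_right h _

theorem sum_range_mul_eq {α : Type*} [AddCommMonoid α] (g : ℕ → α) (k n : ℕ) :
    ∑ m ∈ Finset.range (k * n), g m =
      ∑ b ∈ Finset.range k, ∑ l ∈ Finset.range n, g (b * n + l) := by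
  induction k with
  | zero => simp
  | succ k ih => rw [add_mul, one_mul, Finset.sum_range_add, ih, Finset.sum_range_succ]

variable {d N : ℕ}

open SimAlgorithm in
/-- The noise of the truncated stochastic subgradients is small. -/
theorem ssgd_descent_tail (hd : 0 < d) (hN : 2 ≤ N) (𝓜 : SimModel.{u} d N) {c : ℝ≥0} (hc : 0 < c)
    (hsub : ∀ x, HasSubgaussianMGF (fun y => 𝓜.F x y - 𝓜.objective x) c (𝓜.law x))
    {M L K : ℝ} (hL : LInftyLipschitz L 𝓜.objective) (hK : 0 < K) (hM : L + K ≤ M)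
    {v : Fin d → ℝ} (hv : ∀ k, v k ∈ Set.Icc (1 : ℝ) N) {σ ε δ η : ℝ} (hε : 0 < ε) {T : ℕ}
    (hb : 4 * c / K * Real.exp (-K ^ 2 / (4 * c)) ≤ ε / (8 * d * N)) :
    𝓜.prob {ω | T * (ε / 4) ≤ ∑ m ∈ Finset.range (d * T),
        ssgdWeight hd N M η v m ((ssgd hN σ ε δ T M η).obs (𝓜.output ω)) *
          (𝓜.objective (neighbor hN (ssgdIterate d N M η
              ((ssgd hN σ ε δ T M η).obs (𝓜.output ω)) (m / d)) (m % d + 1)) -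
            𝓜.objective (neighbor hN (ssgdIterate d N M η
              ((ssgd hN σ ε δ T M η).obs (𝓜.output ω)) (m / d)) (m % d)) -
            truncate M ((ssgd hN σ ε δ T M η).obs (𝓜.output ω) (2 * m) -
              (ssgd hN σ ε δ T M η).obs (𝓜.output ω) (2 * m + 1)))} ≤
      ENNReal.ofReal (Real.exp (-(T * (ε ^ 2 / (512 * c * N ^ 2 * d))))) := by
  have hA := ssgd_isMeasurable (d := d) hN σ ε δ T M η
  set A := ssgd (d := d) hN σ ε δ T M η with hAdef
  have hd' : (0 : ℝ) < d := by exact_mod_cast hd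
  have hN' : (0 : ℝ) < N := by
    have : (2 : ℝ) ≤ N := by exact_mod_cast hN
    linarith
  have hc' : (0 : ℝ) < c := hc
  set b := 4 * c / K * Real.exp (-K ^ 2 / (4 * c)) with hbdef
  -- After the bias has used half of the allowance `T ε / 4`, the exponent is `T (s ε / 8 - 2 c d N²
  -- s²)`, and this `s` maximises it. Only the first power of `d` occurs, because each of the `d T`
  -- terms has weight at most `N`.
  set s : ℝ := ε / (32 * c * N ^ 2 * d) with hs
  have hs0 : 0 < s := by positivity
  let Q : ℕ → (ℕ → ℝ) → Grid d N := fun m z =>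
    neighbor hN (ssgdIterate d N M η z (m / d)) (m % d)
  have hQm : ∀ m, Measurable (Q m) := fun m =>
    measurable_neighbor hN (measurable_ssgdIterate d N M η _) _
  let w : ℕ → (ℕ → ℝ) → ℝ := fun m z => s * ssgdWeight hd N M η v m z
  have hwm : ∀ m, Measurable (w m) := fun m => (measurable_ssgdWeight hd N M η v m).const_mul s
  have hmgf := lintegral_exp_sum_truncate_le hA 𝓜 hc hsub hwm
    (fun m z z' h => by simp only [w, ssgdWeight_congr hd N M η v m h]) hQm
    (fun m z z' h => by
      have : d * (m / d) ≤ m := Nat.mul_div_le m d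
      simp only [Q, ssgdIterate_congr d N M η (m / d) fun j hj => h j (by
        rw [mul_assoc] at hj; omega)])
    (k := d * T) (fun m hm z => ssgd_point_odd hN σ ε δ M η hm z) (L := L)
    (fun m hm z => by
      rw [ssgd_point_even hN σ ε δ M η hm z]
      exact abs_objective_neighbor_succ_sub_le hL hN _ _) hK hM
  have hX : Measurable fun z : ℕ → ℝ => ∑ m ∈ Finset.range (d * T),
      (w m z * (𝓜.objective (A.point (2 * m) z) - 𝓜.objective (Q m z) -
        truncate M (z (2 * m) - z (2 * m + 1))) - (2 * c * w m z ^ 2 + |w m z| * b)) := by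
    refine Finset.measurable_sum _ fun m _ => ?_
    have h1 := hwm m
    have h2 := (measurable_objective_comp 𝓜 (measurable_point hA (2 * m))).sub
        (measurable_objective_comp 𝓜 (hQm m))
    have h3 : Measurable fun z : ℕ → ℝ => truncate M (z (2 * m) - z (2 * m + 1)) :=
      (measurable_truncate M).comp (by fun_prop)
    exact (h1.mul (h2.sub h3)).sub (((h1.pow_const 2).const_mul _).add
      ((continuous_abs.measurable.comp h1).mul_const _))
  refine le_trans (measure_mono fun ω hω => ?_)
    (measure_ge_le_exp_neg (hX.comp (measurable_obs hA 𝓜)) hmgf (T * (ε ^ 2 / (512 * c * N ^ 2 * d))))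
  simp only [Set.mem_ofPred_eq, Function.comp] at hω ⊢
  revert hω
  generalize A.obs (𝓜.output ω) = z
  intro hω
  rw [Finset.sum_sub_distrib]
  have h1 : ∑ m ∈ Finset.range (d * T), (2 * c * w m z ^ 2 + |w m z| * b) ≤
      d * T * (2 * c * (s * N) ^ 2 + s * N * b) := by
    have := Finset.sum_le_card_nsmul (Finset.range (d * T))
      (fun m => 2 * c * w m z ^ 2 + |w m z| * b) (2 * c * (s * N) ^ 2 + s * N * b)
      fun m _ => by
        have hw : |w m z| ≤ s * N := by
          simp only [w]
          rw [abs_mul, abs_of_pos hs0]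
          exact mul_le_mul_of_nonneg_left (abs_ssgdWeight_le hd hN M η hv m z) hs0.le
        have hw2 : w m z ^ 2 ≤ (s * N) ^ 2 := sq_le_sq' (abs_le.1 hw).1 (abs_le.1 hw).2
        have hb0 : 0 ≤ b := by positivity
        gcongr
    simpa only [Finset.card_range, nsmul_eq_mul, Nat.cast_mul] using this
  have h2 : d * T * (2 * c * (s * N) ^ 2 + s * N * b) ≤
      d * T * (2 * c * (s * N) ^ 2 + s * N * (ε / (8 * d * N))) := by gcongr
  have h3 : ∑ m ∈ Finset.range (d * T), w m z * (𝓜.objective (A.point (2 * m) z) -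
      𝓜.objective (Q m z) - truncate M (z (2 * m) - z (2 * m + 1))) =
      s * ∑ m ∈ Finset.range (d * T), ssgdWeight hd N M η v m z *
          (𝓜.objective (neighbor hN (ssgdIterate d N M η z (m / d)) (m % d + 1)) -
            𝓜.objective (neighbor hN (ssgdIterate d N M η z (m / d)) (m % d)) -
            truncate M (z (2 * m) - z (2 * m + 1))) := by
    rw [Finset.mul_sum]
    refine Finset.sum_congr rfl fun m hm => ?_
    rw [ssgd_point_even hN σ ε δ M η (Finset.mem_range.1 hm) z]
    simp only [w, Q]
    ring
  have h4 := mul_le_mul_of_nonneg_left hω hs0.le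
  have h5 : s * (T * (ε / 4)) - d * T * (2 * c * (s * N) ^ 2 + s * N * (ε / (8 * d * N))) =
      T * (ε ^ 2 / (512 * c * N ^ 2 * d)) := by
    rw [hs]
    field_simp
    ring
  rw [h3]
  linarith

/-- The index of the best neighbouring point of the averaging point. -/
noncomputable def bestNeighbor (hN : 2 ≤ N) (f : Grid d N → ℝ) (x : Fin d → ℝ) : Fin (d + 1) :=
  argminIndex (m := d) fun i => f (neighbor hN x i)

open SimAlgorithm in
/-- The rounding step prefers a fixed bad neighbouring point to the best one with small
probability. -/
theorem ssgd_rounding_tail (hN : 2 ≤ N) (𝓜 : SimModel.{u} d N) {σ ε δ M η : ℝ}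
    {c : ℝ≥0} (hc : 0 < c) (hcσ : (c : ℝ) = σ ^ 2)
    (hsub : ∀ x, HasSubgaussianMGF (fun y => 𝓜.F x y - 𝓜.objective x) c (𝓜.law x))
    (hε : 0 < ε) (hδ : 0 < δ) (hδ8 : δ < 8) {T : ℕ} (j : ℕ) (hj : j ≤ d) :
    𝓜.prob {ω |
        𝓜.objective (neighbor hN (ssgdAverage d N T M η
          ((ssgd hN σ ε δ T M η).obs (𝓜.output ω))) (bestNeighbor hN 𝓜.objective
            (ssgdAverage d N T M η ((ssgd hN σ ε δ T M η).obs (𝓜.output ω))))) + ε / 2 <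
          𝓜.objective (neighbor hN (ssgdAverage d N T M η
            ((ssgd hN σ ε δ T M η).obs (𝓜.output ω))) j) ∧
        roundingMean d T σ ε δ ((ssgd hN σ ε δ T M η).obs (𝓜.output ω)) j ≤
          roundingMean d T σ ε δ ((ssgd hN σ ε δ T M η).obs (𝓜.output ω))
            (bestNeighbor hN 𝓜.objective
              (ssgdAverage d N T M η ((ssgd hN σ ε δ T M η).obs (𝓜.output ω))))} ≤
      ENNReal.ofReal ((δ / 8) ^ 2) := by
  have hA := ssgd_isMeasurable (d := d) hN σ ε δ T M η
  set A := ssgd (d := d) hN σ ε δ T M η with hAdef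
  have hc' : (0 : ℝ) < c := hc
  set n := roundingSize σ ε δ with hn
  have hlog : 0 < Real.log (8 / δ) := Real.log_pos (by rw [lt_div_iff₀ hδ]; linarith)
  have hnle : 32 * σ ^ 2 / ε ^ 2 * Real.log (8 / δ) ≤ n := Nat.le_ceil _
  have hn0 : (0 : ℝ) < n := lt_of_lt_of_le (by rw [← hcσ]; positivity) hnle
  -- The maximiser of `s ε / 2 - c s²`, the exponent gained per simulation of the two compared
  -- points.
  set s : ℝ := ε / (4 * c) with hs
  have hs0 : 0 < s := by positivity
  let x : (ℕ → ℝ) → Fin d → ℝ := fun z => ssgdAverage d N T M η z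
  have hx : Measurable x := measurable_ssgdAverage d N T M η
  let best : (ℕ → ℝ) → Fin (d + 1) := fun z => bestNeighbor hN 𝓜.objective (x z)
  have hbest : Measurable best := (measurable_argminIndex d).comp (measurable_pi_iff.2 fun i =>
    measurable_objective_comp 𝓜 (measurable_neighbor hN hx i))
  -- Weight `s` on the runs of the best neighbour and `-s` on those of `j` isolates the difference
  -- of the two empirical means. The best neighbour is random, but it is determined by the descent
  -- phase, so the weights are predictable.
  let U : Fin (d + 1) → ℕ → ℝ := fun i b => (if b = (i : ℕ) then s else 0) - if b = j then s else 0
  let w : ℕ → (ℕ → ℝ) → ℝ := fun m z =>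
    if m < 2 * d * T then 0 else U (best z) ((m - 2 * d * T) / n)
  have hwm : ∀ m, Measurable (w m) := by
    intro m
    by_cases hm : m < 2 * d * T
    · simp [w, hm]
    · simp only [w, hm, if_false]
      exact Measurable.apply_of_countable (J := fun i _ => U i ((m - 2 * d * T) / n)) hbest
        fun _ => measurable_const
  have hwdep : ∀ m z z', (∀ j < m, z j = z' j) → w m z = w m z' := by
    intro m z z' h
    by_cases hm : m < 2 * d * T
    · simp [w, hm]
    · simp only [w, best, x, hm, if_false]
      rw [ssgdAverage_congr d N T M η fun j hj => h j (by omega)]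
  have hmgf := lintegral_exp_sum_le hA 𝓜 hsub hwm hwdep (2 * d * T + (d + 1) * n)
  have hX : Measurable fun z : ℕ → ℝ => ∑ m ∈ Finset.range (2 * d * T + (d + 1) * n),
      (w m z * (z m - 𝓜.objective (A.point m z)) - c * w m z ^ 2 / 2) := by
    refine Finset.measurable_sum _ fun m _ => ?_
    have h1 := hwm m
    have h2 := measurable_objective_comp 𝓜 (measurable_point hA m)
    exact (h1.mul ((measurable_pi_apply m).sub h2)).sub
      (((h1.pow_const 2).const_mul _).div_const 2)
  have hfin : Real.exp (-(n * (ε ^ 2 / (16 * c)))) ≤ (δ / 8) ^ 2 := by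
    have h1 : 2 * Real.log (8 / δ) ≤ n * (ε ^ 2 / (16 * c)) := by
      have := mul_le_mul_of_nonneg_right hnle (show 0 ≤ ε ^ 2 / (16 * c) by positivity)
      refine le_trans (le_of_eq ?_) this
      rw [← hcσ]
      field_simp
      norm_num
    calc Real.exp (-(n * (ε ^ 2 / (16 * c)))) ≤ Real.exp (2 * Real.log (δ / 8)) := by
          refine Real.exp_le_exp.2 ?_
          have : Real.log (δ / 8) = -Real.log (8 / δ) := by rw [← Real.log_inv, inv_div]
          linarith
      _ = (δ / 8) ^ 2 := by
          rw [two_mul, Real.exp_add, Real.exp_log (by positivity), sq]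
  refine le_trans (measure_mono fun ω hω => ?_)
    ((measure_ge_le_exp_neg (hX.comp (measurable_obs hA 𝓜)) hmgf
      (n * (ε ^ 2 / (16 * c)))).trans (ENNReal.ofReal_le_ofReal hfin))
  simp only [Set.mem_ofPred_eq, Function.comp] at hω ⊢
  revert hω
  generalize A.obs (𝓜.output ω) = z
  intro hω
  change 𝓜.objective (neighbor hN (x z) (best z)) + ε / 2 < 𝓜.objective (neighbor hN (x z) j) ∧
    roundingMean d T σ ε δ z j ≤ roundingMean d T σ ε δ z (best z) at hω
  have hne : ((best z : Fin (d + 1)) : ℕ) ≠ j := by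
    intro h
    have := hω.1
    rw [h] at this
    linarith
  set i : ℕ := (best z).val with hi
  have hid : i ≤ d := Nat.lt_succ_iff.1 (best z).2
  let D : ℕ → ℝ := fun b => roundingMean d T σ ε δ z b - 𝓜.objective (neighbor hN (x z) b)
  have hsum : ∑ m ∈ Finset.range (2 * d * T + (d + 1) * n),
      (w m z * (z m - 𝓜.objective (A.point m z)) - c * w m z ^ 2 / 2) =
      ∑ b ∈ Finset.range (d + 1), n * (U (best z) b * D b - c * U (best z) b ^ 2 / 2) := by
    rw [Finset.sum_range_add, Finset.sum_eq_zero, zero_add, sum_range_mul_eq]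
    · refine Finset.sum_congr rfl fun b _ => ?_
      have hw : ∀ l ∈ Finset.range n,
          (w (2 * d * T + (b * n + l)) z * (z (2 * d * T + (b * n + l)) -
            𝓜.objective (A.point (2 * d * T + (b * n + l)) z)) -
            c * w (2 * d * T + (b * n + l)) z ^ 2 / 2) =
          U (best z) b * z (2 * d * T + b * n + l) +
          (-U (best z) b * 𝓜.objective (neighbor hN (x z) b) - c * U (best z) b ^ 2 / 2) := by
        intro l hl
        rw [Finset.mem_range] at hl
        have h1 : ¬ 2 * d * T + (b * n + l) < 2 * d * T := by omega
        have h2 : (2 * d * T + (b * n + l) - 2 * d * T) / n = b := by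
          rw [Nat.add_sub_cancel_left, mul_comm, Nat.mul_add_div (by omega),
            Nat.div_eq_of_lt hl, add_zero]
        have h3 : w (2 * d * T + (b * n + l)) z = U (best z) b := by
          simp only [w, h1, h2, if_false]
        have h4 := ssgd_point_rounding (d := d) hN σ ε δ T M η (i := b) hl z
        rw [h3, ← add_assoc, h4]
        ring
      rw [Finset.sum_congr rfl hw, Finset.sum_add_distrib, ← Finset.mul_sum]
      have hmean : ∑ l ∈ Finset.range n, z (2 * d * T + b * n + l) =
          n * roundingMean d T σ ε δ z b := by
        simp only [roundingMean]
        rw [← hn, mul_div_cancel₀ _ hn0.ne']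
      rw [hmean]
      simp only [Finset.sum_const, Finset.card_range, nsmul_eq_mul, D]
      ring
    · intro m hm
      have : m < 2 * d * T := Finset.mem_range.1 hm
      simp [w, this]
  have hUD : ∀ b, U (best z) b * D b - c * U (best z) b ^ 2 / 2 =
      (if b = i then s * D i - c * s ^ 2 / 2 else 0) +
        if b = j then -(s * D j) - c * s ^ 2 / 2 else 0 := by
    intro b
    simp only [U, ← hi]
    by_cases h1 : b = i
    · subst h1
      simp [hne]
    · by_cases h2 : b = j
      · subst h2
        simp [h1]
      · simp [h1, h2]
  rw [hsum, ← Finset.mul_sum, Finset.sum_congr rfl fun b _ => hUD b, Finset.sum_add_distrib,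
    Finset.sum_ite_eq', Finset.sum_ite_eq', if_pos (Finset.mem_range.2 (by omega)),
    if_pos (Finset.mem_range.2 (by omega))]
  refine mul_le_mul_of_nonneg_left ?_ hn0.le
  have hDD : ε / 2 ≤ D i - D j := by
    simp only [D]
    linarith [hω.1, hω.2]
  have h1 := mul_le_mul_of_nonneg_left hDD hs0.le
  have h2 : s * (ε / 2) - c * s ^ 2 = ε ^ 2 / (16 * c) := by
    rw [hs]
    field_simp
    ring
  linarith

open SimAlgorithm in
/-- Truncated subgradient descent with rounding returns an `(ε, δ)`-PGS solution. -/
theorem ssgd_returnsPGS (hd : 0 < d) (hN : 2 ≤ N) {𝓜 : SimModel.{u} d N} {σ ε δ M L K : ℝ}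
    (hσ : 0 < σ) (hL0 : 0 ≤ L) (h𝓜 : 𝓜 ∈ convexModels d N σ L) (hε : 0 < ε) (hδ : 0 < δ)
    (hδd : δ ≤ 1 / ((d : ℝ) + 1)) {T : ℕ} (hT : 0 < T) (hK : 0 < K) (hM : L + K ≤ M)
    (hb : 4 * σ ^ 2 / K * Real.exp (-K ^ 2 / (4 * σ ^ 2)) ≤ ε / (8 * d * N))
    (hTM : d * N * M * √T ≤ T * (ε / 4))
    (hTδ : 2 * Real.log (1 / δ) ≤ T * (ε ^ 2 / (512 * σ ^ 2 * N ^ 2 * d))) :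
    (ssgd (d := d) hN σ ε δ T M (N / (M * √T))).ReturnsPGS 𝓜 ε δ := by
  obtain ⟨hconv, hLip, hsub⟩ := h𝓜
  have hT' : (0 : ℝ) < T := by exact_mod_cast hT
  have hM0 : 0 < M := by linarith
  have hd1 : (1 : ℝ) ≤ d := by exact_mod_cast hd
  have hδ2 : δ ≤ 1 / 2 := hδd.trans (one_div_le_one_div_of_le (by norm_num) (by linarith))
  set c : ℝ≥0 := (σ ^ 2).toNNReal with hcdef
  have hcσ : (c : ℝ) = σ ^ 2 := Real.coe_toNNReal _ (sq_nonneg σ)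
  have hc : 0 < c := Real.toNNReal_pos.2 (by positivity)
  -- The minimiser serves as the comparison point of the regret bound; the explicit neighbour only
  -- shows that the grid is nonempty.
  obtain ⟨q, hq⟩ := @Finite.exists_min (Grid d N) ℝ _ ⟨neighbor hN (fun _ => 0) 0⟩ _ 𝓜.objective
  set η : ℝ := N / (M * √T) with hη
  have hv : ∀ k, ((q k : ℤ) : ℝ) ∈ Set.Icc (1 : ℝ) N := fun k => by
    have := (q k).2
    exact ⟨by exact_mod_cast this.1, by exact_mod_cast this.2⟩
  have tail₁ := ssgd_descent_tail hd hN 𝓜 hc hsub hLip hK hM hv (σ := σ) (δ := δ) (η := η) hε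
    (T := T) (by rwa [hcσ])
  have tail₂ := fun j hj => ssgd_rounding_tail hN 𝓜 (M := M) (η := η) hc hcσ hsub hε hδ
    (by linarith) (T := T) j hj
  unfold ReturnsPGS
  set A := ssgd (d := d) hN σ ε δ T M η with hAdef
  have hp₁ : Real.exp (-(T * (ε ^ 2 / (512 * c * N ^ 2 * d)))) ≤ δ ^ 2 := by
    calc _ ≤ Real.exp (2 * Real.log δ) := by
          refine Real.exp_le_exp.2 ?_
          rw [one_div, Real.log_inv] at hTδ
          rw [hcσ]
          linarith
      _ = δ ^ 2 := by rw [two_mul, Real.exp_add, Real.exp_log hδ, sq]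
  set E₁ := {ω | T * (ε / 4) ≤ ∑ m ∈ Finset.range (d * T),
        ssgdWeight hd N M η (fun k => ((q k : ℤ) : ℝ)) m (A.obs (𝓜.output ω)) *
          (𝓜.objective (neighbor hN (ssgdIterate d N M η
              (A.obs (𝓜.output ω)) (m / d)) (m % d + 1)) -
            𝓜.objective (neighbor hN (ssgdIterate d N M η
              (A.obs (𝓜.output ω)) (m / d)) (m % d)) -
            truncate M (A.obs (𝓜.output ω) (2 * m) - A.obs (𝓜.output ω) (2 * m + 1)))} with hE₁
  set E₂ : ℕ → Set 𝓜.Sample := fun j => {ω |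
        𝓜.objective (neighbor hN (ssgdAverage d N T M η (A.obs (𝓜.output ω)))
          (bestNeighbor hN 𝓜.objective (ssgdAverage d N T M η (A.obs (𝓜.output ω))))) + ε / 2 <
          𝓜.objective (neighbor hN (ssgdAverage d N T M η (A.obs (𝓜.output ω))) j) ∧
        roundingMean d T σ ε δ (A.obs (𝓜.output ω)) j ≤
          roundingMean d T σ ε δ (A.obs (𝓜.output ω))
            (bestNeighbor hN 𝓜.objective (ssgdAverage d N T M η (A.obs (𝓜.output ω))))} with hE₂
  set good := {ω | ∀ y, 𝓜.objective (A.result (𝓜.output ω)) ≤ 𝓜.objective y + ε} with hgood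
  have hcover : Set.univ ⊆ good ∪ (E₁ ∪ ⋃ j ∈ Finset.range (d + 1), E₂ j) := by
    intro ω _
    by_contra hω
    simp only [Set.mem_union, Set.mem_iUnion, not_or, not_exists] at hω
    obtain ⟨h0, h1, h2⟩ := hω
    apply h0
    have hres := ssgd_result (d := d) hN σ ε δ T M η (𝓜.output ω)
    rw [← hAdef] at hres
    simp only [hE₁, hE₂, hgood, Set.mem_ofPred_eq, hres] at h1 h2 ⊢
    clear hres h0
    generalize A.obs (𝓜.output ω) = z at *
    intro y
    have herr := ssgdAverage_error_le hd hN hconv hM0 hT q z hη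
    -- Half of `ε` is spent here: `ε/4` on the regret and `ε/4` on the noise. The other half is left
    -- for rounding.
    have hlov : lovaszExt hN 𝓜.objective (ssgdAverage d N T M η z) - 𝓜.objective q ≤ ε / 2 := by
      refine le_of_mul_le_mul_left (a := (T : ℝ)) ?_ hT'
      linarith [not_le.1 h1]
    have hbest : 𝓜.objective (neighbor hN (ssgdAverage d N T M η z)
        (bestNeighbor hN 𝓜.objective (ssgdAverage d N T M η z))) ≤
        lovaszExt hN 𝓜.objective (ssgdAverage d N T M η z) :=
      exists_neighbor_le_lovaszExt hN _ (ssgdAverage_mem hN hT M η z) fun i hi =>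
        argminIndex_le (fun i : Fin (d + 1) => 𝓜.objective (neighbor hN _ i)) ⟨i, by omega⟩
    set a : Fin (d + 1) := argminIndex (m := d) fun i => roundingMean d T σ ε δ z i with ha
    have h3 := h2 a (Finset.mem_range.2 a.2)
    have h4 : roundingMean d T σ ε δ z a ≤ roundingMean d T σ ε δ z
        (bestNeighbor hN 𝓜.objective (ssgdAverage d N T M η z)) :=
      argminIndex_le (fun i : Fin (d + 1) => roundingMean d T σ ε δ z i) _
    have h5 : ¬ (𝓜.objective (neighbor hN (ssgdAverage d N T M η z)
        (bestNeighbor hN 𝓜.objective (ssgdAverage d N T M η z))) + ε / 2 <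
        𝓜.objective (neighbor hN (ssgdAverage d N T M η z) a)) := fun h => h3 ⟨h, h4⟩
    linarith [hq y, not_lt.1 h5]
  have hP := measure_mono (μ := 𝓜.prob) hcover
  rw [measure_univ] at hP
  have hbad : 𝓜.prob (E₁ ∪ ⋃ j ∈ Finset.range (d + 1), E₂ j) ≤ ENNReal.ofReal δ := by
    calc _ ≤ 𝓜.prob E₁ + ∑ j ∈ Finset.range (d + 1), 𝓜.prob (E₂ j) :=
          (measure_union_le _ _).trans (add_le_add le_rfl (measure_biUnion_finset_le _ _))
      _ ≤ ENNReal.ofReal (δ ^ 2) + ∑ j ∈ Finset.range (d + 1), ENNReal.ofReal ((δ / 8) ^ 2) :=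
          add_le_add (tail₁.trans (ENNReal.ofReal_le_ofReal hp₁))
            (Finset.sum_le_sum fun j hj => tail₂ j (Nat.lt_succ_iff.1 (Finset.mem_range.1 hj)))
      _ = ENNReal.ofReal (δ ^ 2 + (d + 1) * (δ / 8) ^ 2) := by
          rw [Finset.sum_const, Finset.card_range, ← ENNReal.ofReal_nsmul,
            ← ENNReal.ofReal_add (by positivity) (by positivity)]
          simp
      _ ≤ ENNReal.ofReal δ := by
          refine ENNReal.ofReal_le_ofReal ?_
          have h1 : (d + 1) * δ ≤ 1 := by
            rw [le_div_iff₀ (by positivity)] at hδd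
            linarith
          -- Here `δ² ≤ δ / 2` since `δ ≤ 1/2`, and `(d + 1) (δ/8)² ≤ δ / 64` since `(d + 1) δ ≤ 1`.
          nlinarith
  have h1 := hP.trans (measure_union_le _ _)
  have h2 := h1.trans (add_le_add le_rfl hbad)
  rw [ENNReal.ofReal_sub _ hδ.le, ENNReal.ofReal_one]
  exact tsub_le_iff_right.2 h2

end Guarantee

/-! ### Choice of the parameters. -/

section Parameters

/-- `T` is proportional to `C` and occurs in a logarithm inside `M`, so `C` has to dominate its own
logarithm. The tangent bound for `log` at `4 a` costs half of `C`; the other half pays for the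
constants. -/
theorem exists_iteration_constant {σ : ℝ} (hσ : 0 < σ) : ∃ C : ℝ, 1 ≤ C ∧ 2048 * σ ^ 2 ≤ C ∧
    48 * (1 + 16 * σ ^ 2 + 2 * (32 * σ ^ 2) ^ 2) + 384 * σ ^ 2 * Real.log (2 * C) ≤ C := by
  set a := 384 * σ ^ 2 with ha
  have ha0 : 0 < a := by positivity
  set b := 48 * (1 + 16 * σ ^ 2 + 2 * (32 * σ ^ 2) ^ 2) with hb
  have hb0 : 0 < b := by positivity
  set C := 1 + 2048 * σ ^ 2 + 2 * (b + a * |Real.log (4 * a)|) with hC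
  have hσ2 : 0 < σ ^ 2 := by positivity
  have habs : 0 ≤ a * |Real.log (4 * a)| := by positivity
  have hC0 : 0 < C := by positivity
  refine ⟨C, by linarith, by linarith, ?_⟩
  have h1 : Real.log (2 * C) ≤ 2 * C / (4 * a) + Real.log (4 * a) := by
    have := Real.log_le_sub_one_of_pos (show 0 < 2 * C / (4 * a) by positivity)
    rw [Real.log_div (by positivity) (by positivity)] at this
    linarith
  have h2 := mul_le_mul_of_nonneg_left h1 ha0.le
  have h3 : a * (2 * C / (4 * a) + Real.log (4 * a)) = C / 2 + a * Real.log (4 * a) := by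
    field_simp
    ring
  have h4 := mul_le_mul_of_nonneg_left (le_abs_self (Real.log (4 * a))) ha0.le
  linarith

/-- The truncation bias is small for the threshold `L + K`. -/
theorem truncation_bias_le {σ ε D N T : ℝ} (hσ : 0 < σ) (hε : 0 < ε) (hD : 0 < D) (hN : 0 < N)
    (hT : 1 ≤ T) {K : ℝ} (hK : K = 2 * σ * √(Real.log (D * N * T / ε)) + 32 * σ ^ 2) :
    4 * σ ^ 2 / K * Real.exp (-K ^ 2 / (4 * σ ^ 2)) ≤ ε / (8 * D * N) := by
  have hs : 0 ≤ √(Real.log (D * N * T / ε)) := Real.sqrt_nonneg _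
  have hσ2 : 0 < σ ^ 2 := by positivity
  have hK1 : 32 * σ ^ 2 ≤ K := by rw [hK]; nlinarith [mul_nonneg hσ.le hs]
  have hK0 : 0 < K := by linarith
  -- The additive `32 σ²` in `K` is there for this factor, and the square root term for the
  -- exponential.
  have h1 : 4 * σ ^ 2 / K ≤ 1 / 8 := by
    rw [div_le_iff₀ hK0]
    linarith
  have hK2 : 4 * σ ^ 2 * √(Real.log (D * N * T / ε)) ^ 2 ≤ K ^ 2 := by
    have : (2 * σ * √(Real.log (D * N * T / ε))) ^ 2 ≤ K ^ 2 :=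
      pow_le_pow_left₀ (by positivity) (by rw [hK]; linarith) 2
    linarith
  have h2 : Real.exp (-K ^ 2 / (4 * σ ^ 2)) ≤ ε / (D * N) := by
    have hle : Real.exp (-K ^ 2 / (4 * σ ^ 2)) ≤
        Real.exp (-(√(Real.log (D * N * T / ε)) ^ 2)) := by
      refine Real.exp_le_exp.2 ?_
      rw [div_le_iff₀ (by positivity)]
      linarith
    have hle2 : ε / (D * N * T) ≤ ε / (D * N) := by
      apply div_le_div_of_nonneg_left hε.le (by positivity)
      exact le_mul_of_one_le_right (by positivity) hT
    rcases le_total 0 (Real.log (D * N * T / ε)) with h | h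
    · rw [Real.sq_sqrt h, ← Real.log_inv, Real.exp_log (by positivity), inv_div] at hle
      exact hle.trans hle2
    -- Here the square root is read as `0`, but the target `ε / (D N)` is at least `1` anyway.
    · have h3 : D * N * T / ε ≤ 1 := by
        by_contra hcon
        exact absurd (Real.log_pos (not_le.1 hcon)) (not_lt.2 h)
      have h4 : 1 ≤ ε / (D * N * T) := by
        rw [le_div_iff₀ (by positivity)]
        rw [div_le_iff₀ hε] at h3
        linarith
      refine le_trans (Real.exp_le_one_iff.2 ?_) (h4.trans hle2)
      rw [neg_div, neg_nonpos]
      positivity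
  calc 4 * σ ^ 2 / K * Real.exp (-K ^ 2 / (4 * σ ^ 2)) ≤ 1 / 8 * (ε / (D * N)) :=
        mul_le_mul h1 h2 (Real.exp_pos _).le (by norm_num)
    _ = ε / (8 * D * N) := by
        field_simp

/-- The number of iterations suffices for the regret bound. -/
theorem regret_le_of_iterations {σ ε D N L C R T K : ℝ} (hσ : 0 < σ) (hε : 0 < ε) (hD : 0 < D)
    (hN : 0 < N) (hC1 : 1 ≤ C)
    (hC : 48 * (1 + 16 * σ ^ 2 + 2 * (32 * σ ^ 2) ^ 2) + 384 * σ ^ 2 * Real.log (2 * C) ≤ C)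
    (hR : 1 / 2 ≤ R) (hRlog : Real.log (D * N / ε) ≤ R) (hB : 1 ≤ D ^ 2 * N ^ 2 / ε ^ 2 * R)
    (hLR : L ^ 2 ≤ R) (hT : C * (D ^ 2 * N ^ 2 / ε ^ 2 * R) ≤ T)
    (hT2 : T ≤ C * (D ^ 2 * N ^ 2 / ε ^ 2 * R) + 1)
    (hK : K = 2 * σ * √(Real.log (D * N * T / ε)) + 32 * σ ^ 2) :
    D * N * (L + K) * √T ≤ T * (ε / 4) := by
  set B := D ^ 2 * N ^ 2 / ε ^ 2 with hBdef
  have hB0 : 0 < B := by positivity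
  have hR0 : 0 < R := by linarith
  have hT0 : 0 < T := lt_of_lt_of_le (by positivity) hT
  set Λ := Real.log (D * N * T / ε) with hΛ
  have hlog2C : 0 ≤ Real.log (2 * C) := Real.log_nonneg (by linarith)
  have hT3 : T ≤ 2 * C * (B * R) := by nlinarith
  -- Inserting the upper bound for `T` leaves three copies of `log (D N / ε) ≤ R` and one `log R ≤
  -- R`. This ends the circularity between `M` and `T`.
  have hΛle : Λ ≤ Real.log (2 * C) + 4 * R := by
    have h1 : D * N * T / ε ≤ 2 * C * ((D * N / ε) ^ 3 * R) := by
      calc D * N * T / ε = D * N / ε * T := by ring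
        _ ≤ D * N / ε * (2 * C * (B * R)) := by gcongr
        _ = 2 * C * ((D * N / ε) ^ 3 * R) := by rw [hBdef]; field_simp
    have h2 := Real.log_le_log (by positivity) h1
    rw [Real.log_mul (x := 2 * C) (by positivity) (by positivity),
      Real.log_mul (x := (D * N / ε) ^ 3) (by positivity) (by positivity), Real.log_pow] at h2
    have h3 := Real.log_le_sub_one_of_pos hR0
    push_cast at h2
    linarith
  have hs : √Λ ^ 2 ≤ Real.log (2 * C) + 4 * R := by
    rcases le_total 0 Λ with h | h
    · rw [Real.sq_sqrt h]; exact hΛle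
    · rw [Real.sqrt_eq_zero_of_nonpos h]; nlinarith
  -- The square of three summands costs a factor 3, and `1 ≤ 2 R` absorbs the terms without `R`; the
  -- hypothesis `hC` collects the resulting constants.
  have hM : 16 * (L + K) ^ 2 ≤ C * R := by
    have h1 : (L + K) ^ 2 ≤ 3 * (L ^ 2 + (2 * σ * √Λ) ^ 2 + (32 * σ ^ 2) ^ 2) := by
      rw [hK]
      nlinarith [sq_nonneg (L - 2 * σ * √Λ), sq_nonneg (L - 32 * σ ^ 2),
        sq_nonneg (2 * σ * √Λ - 32 * σ ^ 2)]
    have h2 : (2 * σ * √Λ) ^ 2 ≤ 4 * σ ^ 2 * (2 * R * Real.log (2 * C) + 4 * R) := by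
      rw [mul_pow, mul_pow]
      have h3 : Real.log (2 * C) ≤ 2 * R * Real.log (2 * C) := by nlinarith
      have := mul_le_mul_of_nonneg_left (hs.trans (add_le_add h3 le_rfl))
        (show 0 ≤ 4 * σ ^ 2 by positivity)
      linarith
    have h3 : (32 * σ ^ 2) ^ 2 ≤ 2 * R * (32 * σ ^ 2) ^ 2 := by
      have : 0 ≤ (32 * σ ^ 2) ^ 2 := by positivity
      nlinarith
    have h4 := mul_le_mul_of_nonneg_right hC hR0.le
    nlinarith
  have hsqT : √T * √T = T := Real.mul_self_sqrt hT0.le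
  have hsT : 0 < √T := Real.sqrt_pos.2 hT0
  have hK0 : 0 ≤ K := by rw [hK]; positivity
  have key : D * N * (L + K) ≤ √T * (ε / 4) := by
    refine le_of_sq_le_sq ?_ (by positivity)
    have h1 : (√T * (ε / 4)) ^ 2 = T * ε ^ 2 / 16 := by
      rw [mul_pow, sq (√T), hsqT]; ring
    rw [h1]
    have h2 : C * (B * R) * ε ^ 2 / 16 ≤ T * ε ^ 2 / 16 := by gcongr
    refine le_trans ?_ h2
    have h3 : C * (B * R) * ε ^ 2 / 16 = (D * N) ^ 2 * (C * R) / 16 := by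
      rw [hBdef]; field_simp
    rw [h3]
    have h4 := mul_le_mul_of_nonneg_left hM (sq_nonneg (D * N))
    rw [mul_pow]
    linarith
  calc D * N * (L + K) * √T ≤ √T * (ε / 4) * √T := by gcongr
    _ = T * (ε / 4) := by
        have : √T * (ε / 4) * √T = √T * √T * (ε / 4) := by ring
        rw [this, hsqT]

/-- The number of simulations is at most a multiple of the size of the problem. -/
theorem cost_le {σ ε δ N C R : ℝ} {d T : ℕ} (hd : 1 ≤ d) (hε : 0 < ε) (hδ : 0 < δ)
    (hN : 2 ≤ N) (hA : Real.log 2 ≤ Real.log (1 / δ)) (hB : 1 ≤ (d : ℝ) ^ 2 * N ^ 2 / ε ^ 2 * R)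
    (hAR : Real.log (1 / δ) / (2 * d) ≤ R)
    (hT2 : (T : ℝ) ≤ C * ((d : ℝ) ^ 2 * N ^ 2 / ε ^ 2 * R) + 1) :
    (ssgdCost d T σ ε δ : ℝ) ≤
      (2 * (C + 1) + 2 * (64 * σ ^ 2 + 1)) * (d * ((d : ℝ) ^ 2 * N ^ 2 / ε ^ 2 * R)) := by
  have hd1 : (1 : ℝ) ≤ d := by exact_mod_cast hd
  set Q := (d : ℝ) ^ 2 * N ^ 2 / ε ^ 2 * R with hQ
  set A := Real.log (1 / δ) with hAdef
  have hlog2 : 0 < Real.log 2 := Real.log_pos (by norm_num)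
  have hlog8 : Real.log (8 / δ) ≤ 4 * A := by
    have h1 : (8 : ℝ) / δ = 2 ^ 3 * (1 / δ) := by ring
    rw [h1, Real.log_mul (by norm_num) (by positivity), Real.log_pow]
    push_cast
    linarith
  have hlog0 : 0 ≤ Real.log (8 / δ) := by
    have : Real.log (1 / δ) ≤ Real.log (8 / δ) :=
      Real.log_le_log (by positivity) (by gcongr; norm_num)
    linarith
  have hAQ : 2 * (A / ε ^ 2) ≤ Q := by
    calc 2 * (A / ε ^ 2) ≤ (d * N ^ 2 / 2) * (A / ε ^ 2) := by
          refine mul_le_mul_of_nonneg_right ?_ (by have : 0 ≤ A := by linarith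
                                                   positivity)
          nlinarith
      _ = (d : ℝ) ^ 2 * N ^ 2 / ε ^ 2 * (A / (2 * d)) := by field_simp
      _ ≤ Q := by rw [hQ]; gcongr
  have hn : (roundingSize σ ε δ : ℝ) ≤ (64 * σ ^ 2 + 1) * Q := by
    have h1 : (roundingSize σ ε δ : ℝ) < 32 * σ ^ 2 / ε ^ 2 * Real.log (8 / δ) + 1 :=
      Nat.ceil_lt_add_one (by positivity)
    have h2 : 32 * σ ^ 2 / ε ^ 2 * Real.log (8 / δ) ≤ 32 * σ ^ 2 / ε ^ 2 * (4 * A) := by gcongr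
    have h3 : 32 * σ ^ 2 / ε ^ 2 * (4 * A) = 64 * σ ^ 2 * (2 * (A / ε ^ 2)) := by ring
    have h4 : 64 * σ ^ 2 * (2 * (A / ε ^ 2)) ≤ 64 * σ ^ 2 * Q := by gcongr
    linarith
  have hT3 : (T : ℝ) ≤ (C + 1) * Q := by linarith
  have hnQ : 0 ≤ (roundingSize σ ε δ : ℝ) := Nat.cast_nonneg _
  calc (ssgdCost d T σ ε δ : ℝ) = 2 * d * T + (d + 1) * roundingSize σ ε δ := by
        unfold ssgdCost; push_cast; ring
    _ ≤ 2 * d * ((C + 1) * Q) + (2 * d) * ((64 * σ ^ 2 + 1) * Q) := by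
        gcongr
        linarith
    _ = _ := by ring

/-- The parameter regime of the cost bound. -/
theorem exists_confidence_threshold {d : ℕ} (hd : 1 ≤ d) {N L ε : ℝ} (hN : 2 ≤ N) (hε : 0 < ε) :
    ∃ δ₀ : ℝ, 0 < δ₀ ∧ δ₀ ≤ 1 / ((d : ℝ) + 1) ∧ (ε ≤ 1 → 1 / ((d : ℝ) + 1) ≤ δ₀) ∧
      ∀ δ : ℝ, 0 < δ → δ ≤ δ₀ → ∀ R : ℝ,
        R = Real.log (1 / δ) / d + Real.log (d ^ 2 * N / ε ^ 3) + L ^ 2 →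
        1 / 2 ≤ R ∧ Real.log (d * N / ε) ≤ R ∧ Real.log (1 / δ) / (2 * d) ≤ R ∧
          1 ≤ (d : ℝ) ^ 2 * N ^ 2 / ε ^ 2 * R ∧ L ^ 2 ≤ R := by
  have hd1 : (1 : ℝ) ≤ d := by exact_mod_cast hd
  have hd0 : (0 : ℝ) < d := by linarith
  have hN0 : 0 < N := by linarith
  have hlog2 : 1 / 2 ≤ Real.log 2 := by linarith [Real.log_two_gt_d9]
  have hhalf : ∀ A : ℝ, A / (2 * d) = A / d / 2 := fun A => by field_simp
  -- For `ε ≤ 1` all summands of `R` are nonnegative and the logarithm is at least `log 2`. For `ε >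
  -- 1` the logarithm may be negative, and `δ` is taken so small that half of `log (1/δ) / d`
  -- outweighs it.
  rcases le_or_gt ε 1 with hε1 | hε1
  · refine ⟨1 / ((d : ℝ) + 1), by positivity, le_rfl, fun _ => le_rfl, fun δ hδ hδ0 R hR => ?_⟩
    have hA : 0 ≤ Real.log (1 / δ) := by
      refine Real.log_nonneg ?_
      rw [le_div_iff₀ hδ, one_mul]
      exact hδ0.trans (by rw [div_le_one (by positivity)]; linarith)
    have hAd : 0 ≤ Real.log (1 / δ) / d := by positivity
    have hL2 := sq_nonneg L
    have h1 : d * N / ε ≤ d ^ 2 * N / ε ^ 3 := by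
      rw [div_le_div_iff₀ hε (by positivity)]
      have h2 : ε ^ 3 ≤ ε := by
        have := pow_le_pow_of_le_one hε.le hε1 (show 1 ≤ 3 by norm_num)
        simpa using this
      have h3 : (d : ℝ) ≤ d ^ 2 := by nlinarith
      gcongr
    have h2 : 2 ≤ d * N / ε := by
      rw [le_div_iff₀ hε]
      nlinarith
    have hl1 := Real.log_le_log (by positivity) h1
    have hl2 := Real.log_le_log (by positivity) h2
    refine ⟨by linarith, by linarith, ?_, ?_, by linarith⟩
    · rw [hhalf]
      linarith
    · have h4 : 4 ≤ (d : ℝ) ^ 2 * N ^ 2 / ε ^ 2 := by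
        have := pow_le_pow_left₀ (by norm_num) h2 2
        rw [div_pow, mul_pow] at this
        linarith
      nlinarith
  · set B := (d : ℝ) ^ 2 * N ^ 2 / ε ^ 2 with hB
    have hB0 : 0 < B := by positivity
    set A₀ := 2 * d * (|Real.log (d ^ 2 * N / ε ^ 3)| + |Real.log (d * N / ε)| + 1 + 1 / B) with hA₀
    refine ⟨min (1 / ((d : ℝ) + 1)) (Real.exp (-A₀)), lt_min (by positivity) (Real.exp_pos _),
      min_le_left _ _, fun h => absurd h (not_le.2 hε1), fun δ hδ hδ0 R hR => ?_⟩
    have hA : A₀ ≤ Real.log (1 / δ) := by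
      rw [one_div, Real.log_inv, le_neg]
      calc Real.log δ ≤ Real.log (Real.exp (-A₀)) :=
            Real.log_le_log hδ (hδ0.trans (min_le_right _ _))
        _ = -A₀ := Real.log_exp _
    have hA2 : |Real.log (d ^ 2 * N / ε ^ 3)| + |Real.log (d * N / ε)| + 1 + 1 / B ≤
        Real.log (1 / δ) / (2 * d) := by
      rw [le_div_iff₀ (by positivity)]
      linarith
    have h1 := neg_abs_le (Real.log (d ^ 2 * N / ε ^ 3))
    have h2 := le_abs_self (Real.log (d * N / ε))
    have h3 := abs_nonneg (Real.log (d * N / ε))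
    have h4 := abs_nonneg (Real.log (d ^ 2 * N / ε ^ 3))
    have h5 : 0 < 1 / B := by positivity
    have hL2 := sq_nonneg L
    have h6 := hhalf (Real.log (1 / δ))
    refine ⟨by linarith, by linarith, by linarith, ?_, by linarith⟩
    have h7 : 1 / B ≤ R := by linarith
    calc 1 = B * (1 / B) := by field_simp
      _ ≤ B * R := by gcongr

end Parameters

/-! ### The main theorem. -/

theorem expectedSimulationCost_le {d N : ℕ} {𝓒 : Set (SimModel.{u} d N)} {A : SimAlgorithm d N}
    {ε δ : ℝ} (hA : A.IsPGSAlgorithm 𝓒 ε δ) {n : ℕ} (hn : ∀ out, A.stopTime out = n) {x : ℝ}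
    (hx : n ≤ x) : expectedSimulationCost 𝓒 ε δ ≤ ENNReal.ofReal x := by
  refine iInf₂_le_of_le A hA (iSup₂_le fun 𝓜 _ => ?_)
  simp only [hn, ENat.toENNReal_coe, lintegral_const, measure_univ, mul_one]
  rw [← ENNReal.ofReal_natCast]
  exact ENNReal.ofReal_le_ofReal hx

theorem mainTheorem1 (σ : ℝ) (hσ : 0 < σ) :
    ∃ a₁ a₂ b₁ b₂ c₁ c₂ : ℝ, 0 < a₁ ∧ 0 < a₂ ∧ 0 < b₁ ∧ 0 < b₂ ∧ 0 < c₁ ∧ 0 < c₂ ∧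
    ∀ (d N : ℕ) (_hd : 1 ≤ d) (hN : 2 ≤ N) (L ε : ℝ), 0 ≤ L → 0 < ε →
      ∃ δ₀ a₃ b₃ c₃ : ℝ, 0 < δ₀ ∧ (ε ≤ 1 → 1 / ((d : ℝ) + 1) ≤ δ₀) ∧
      ∀ δ : ℝ, 0 < δ → δ ≤ δ₀ →
        ∃ (T : ℕ) (M : ℝ), 0 < T ∧ 0 < M ∧
          (a₁ * (d * N ^ 2 / ε ^ 2 * Real.log (1 / δ)) ≤ T ∧
            T ≤ a₂ * (d * N ^ 2 / ε ^ 2 * Real.log (1 / δ)) + a₃) ∧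
          (b₁ * √(Real.log (d * N * T / ε)) ≤ M ∧
            M ≤ b₂ * √(Real.log (d * N * T / ε)) + b₃) ∧
          (ssgd (d := d) hN σ ε δ T M (N / (M * √T))).IsPGSAlgorithm
            (convexModels.{u} d N σ L) ε δ ∧
          (∀ 𝓜 ∈ convexModels.{u} d N σ L, ∀ᵐ ω ∂𝓜.prob,
            (((ssgd (d := d) hN σ ε δ T M (N / (M * √T))).stopTime (𝓜.output ω) : ℕ∞) : ENNReal) ≤
              ENNReal.ofReal (c₁ *
                (d ^ 2 * N ^ 2 / ε ^ 2 * Real.log (1 / δ) +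
                  d ^ 3 * N ^ 2 / ε ^ 2 * Real.log (d ^ 2 * N / ε ^ 3) +
                  d ^ 3 * N ^ 2 * L ^ 2 / ε ^ 2))) ∧
          expectedSimulationCost (convexModels.{u} d N σ L) ε δ ≤
            ENNReal.ofReal (c₁ *
              (d ^ 2 * N ^ 2 / ε ^ 2 * Real.log (1 / δ) +
                d ^ 3 * N ^ 2 / ε ^ 2 * Real.log (d ^ 2 * N / ε ^ 3) +
                d ^ 3 * N ^ 2 * L ^ 2 / ε ^ 2)) ∧
          expectedSimulationCost (convexModels.{u} d N σ L) ε δ ≤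
            ENNReal.ofReal (c₂ * (d ^ 2 * N ^ 2 / ε ^ 2 * Real.log (1 / δ)) + c₃) := by

  obtain ⟨C, hC1, hCσ, hC⟩ := exists_iteration_constant hσ
  have hC0 : 0 < C := by linarith
  set c₁ := 2 * (C + 1) + 2 * (64 * σ ^ 2 + 1) with hc₁
  have hc₁0 : 0 < c₁ := by positivity
  -- The lower constant is `C / 2` because a negative logarithm may consume half of `log (1/δ) / d`
  -- in `R`. Both threshold constants are `2 σ`, since the square root enters `M` with that exact
  -- factor.
  refine ⟨C / 2, C, 2 * σ, 2 * σ, c₁, c₁, by positivity, hC0, by positivity, by positivity, hc₁0,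
    hc₁0, fun d N hd hN L ε hL hε => ?_⟩
  have hNr : (2 : ℝ) ≤ N := by exact_mod_cast hN
  have hN0 : (0 : ℝ) < N := by linarith
  have hd1 : (1 : ℝ) ≤ d := by exact_mod_cast hd
  have hd0 : (0 : ℝ) < d := by linarith
  obtain ⟨δ₀, hδ₀, hδ₀d, hδ₀ε, hδ₀R⟩ := exists_confidence_threshold hd hNr hε (L := L)
  set B : ℝ := (d : ℝ) ^ 2 * N ^ 2 / ε ^ 2 with hB
  have hB0 : 0 < B := by positivity
  set l : ℝ := Real.log (d ^ 2 * N / ε ^ 3) with hl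
  -- The `δ`-independent summands of `R` go into the additive constants; the `+ 1` comes from
  -- rounding `T` up.
  refine ⟨δ₀, C * (B * (l + L ^ 2)) + 1, L + 32 * σ ^ 2, c₁ * (d * (B * (l + L ^ 2))), hδ₀, hδ₀ε,
    fun δ hδ hδδ₀ => ?_⟩
  obtain ⟨hR, hRlog, hAR, hBR, hLR⟩ := hδ₀R δ hδ hδδ₀ _ rfl
  set R : ℝ := Real.log (1 / δ) / d + l + L ^ 2 with hRdef
  have hδd := hδδ₀.trans hδ₀d
  have hA2 : Real.log 2 ≤ Real.log (1 / δ) := by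
    refine Real.log_le_log (by norm_num) ?_
    rw [le_div_iff₀ hδ]
    rw [le_div_iff₀ (by positivity)] at hδd
    nlinarith
  have hA0 : 0 < Real.log (1 / δ) := (Real.log_pos (by norm_num)).trans_le hA2
  set T : ℕ := ⌈C * (B * R)⌉₊ with hT
  have hT1 : C * (B * R) ≤ T := Nat.le_ceil _
  have hT2 : (T : ℝ) ≤ C * (B * R) + 1 := (Nat.ceil_lt_add_one (by positivity)).le
  have hTge : (1 : ℝ) ≤ T := by nlinarith
  have hT0 : 0 < T := by exact_mod_cast (by linarith : (0 : ℝ) < T)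
  set K : ℝ := 2 * σ * √(Real.log (d * N * T / ε)) + 32 * σ ^ 2 with hK
  have hK0 : 0 < K := by positivity
  have hdBA : d * N ^ 2 / ε ^ 2 * Real.log (1 / δ) = B * (Real.log (1 / δ) / d) := by
    rw [hB]; field_simp
  have hTlow : C / 2 * (d * N ^ 2 / ε ^ 2 * Real.log (1 / δ)) ≤ T := by
    refine le_trans ?_ hT1
    rw [hdBA]
    have h1 := mul_le_mul_of_nonneg_left hAR (show 0 ≤ C * B by positivity)
    calc C / 2 * (B * (Real.log (1 / δ) / d)) = C * B * (Real.log (1 / δ) / (2 * d)) := by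
          field_simp
      _ ≤ C * (B * R) := by linarith
  have hPGS : (ssgd (d := d) hN σ ε δ T (L + K) (N / ((L + K) * √T))).IsPGSAlgorithm
      (convexModels.{u} d N σ L) ε δ := by
    refine ⟨ssgd_isMeasurable hN σ ε δ T _ _, fun 𝓜 h𝓜 => ⟨Filter.Eventually.of_forall fun ω => ?_,
      ssgd_returnsPGS hd hN hσ hL h𝓜 hε hδ hδd hT0 hK0 le_rfl
        (truncation_bias_le hσ hε hd0 hN0 hTge hK)
        (regret_le_of_iterations hσ hε hd0 hN0 hC1 hC hR hRlog hBR hLR hT1 hT2 hK) ?_⟩⟩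
    · rw [ssgd_stopTime]
      exact ENat.natCast_lt_top _
    -- The factor `1024 = 2 * 512` is covered by `C / 2`, since `C ≥ 2048 σ²`.
    · calc 2 * Real.log (1 / δ) = 1024 * σ ^ 2 * (d * N ^ 2 / ε ^ 2 * Real.log (1 / δ)) *
            (ε ^ 2 / (512 * σ ^ 2 * N ^ 2 * d)) := by
            field_simp
            norm_num
        _ ≤ T * (ε ^ 2 / (512 * σ ^ 2 * N ^ 2 * d)) := by
            refine mul_le_mul_of_nonneg_right (le_trans ?_ hTlow) (by positivity)
            exact mul_le_mul_of_nonneg_right (by linarith) (by positivity)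
  have hcost := cost_le (σ := σ) hd hε hδ hNr hA2 hBR hAR hT2
  have hsize : d * (B * R) = d ^ 2 * N ^ 2 / ε ^ 2 * Real.log (1 / δ) +
      d ^ 3 * N ^ 2 / ε ^ 2 * l + d ^ 3 * N ^ 2 * L ^ 2 / ε ^ 2 := by
    rw [hB, hRdef]; field_simp
  have hcost' := hcost
  rw [← hB, hsize, ← hc₁] at hcost'
  refine ⟨T, L + K, hT0, by positivity, ⟨hTlow, ?_⟩, ⟨by linarith [sq_nonneg σ], by linarith⟩,
    hPGS, fun 𝓜 _ => Filter.Eventually.of_forall fun ω => ?_,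
    expectedSimulationCost_le hPGS (ssgd_stopTime hN σ ε δ T _ _) hcost',
    expectedSimulationCost_le hPGS (ssgd_stopTime hN σ ε δ T _ _) (hcost.trans (le_of_eq ?_))⟩
  · rw [hdBA]
    linarith
  · rw [ssgd_stopTime, ENat.toENNReal_coe, ← ENNReal.ofReal_natCast]
    exact ENNReal.ofReal_le_ofReal hcost'
  · rw [← hc₁, ← hB, hRdef, hB]
    field_simp
    ring
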